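/- Let $d\ge 0$ be an integer, $B>0$, $\lambda\ge 0$, $\mathcal W=\{w\in\mathbb R^d:\|w\|_1\le B\}$, let $z$ be a random variable with law $\mathbb P$, and let $f(w,z)$ be a real random function with $f(w,\cdot)$ integrable for every $w\in\mathcal W$. Put $F(w)=\mathbb E_z[f(w,z)]$, $P(w)=F(w)+\lambda\|w\|_1$, $P_*=\min_{w\in\mathcal W}P(w)$ and $\mathcal W_*=\arg\min_{w\in\mathcal W}P(w)$. Assume that $P$ is convex on $\mathcal W$ and that on $\mathcal W$ the function $F$ is either quadratic, $F(w)=w^\top Aw+w^\top b+c$, or piecewise linear (affine on each of finitely many polyhedra covering $\mathcal W$). For $\alpha>0$, the problem satisfies EBC$(1,\alpha)$ if $\|w-w^*\|_2^2\le\alpha\,(P(w)-P(w^*))$ for all $w\in\mathcal W$, where $w^*$ is the point of $\mathcal W_*$ closest to $w$. (1) There is $\alpha>0$ such that the problem satisfies EBC$(1,\alpha)$. Now let $\alpha>0$ be such that EBC$(1,\alpha)$ holds, assume that $f(\cdot,z)$ is $G$-Lipschitz on $\mathcal W$ in the Euclidean norm for every $z$ (with $G>0$), and let $z_1,z_2,\dots$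 be i.i.d. with law $\mathbb P$. Then the following hold. (2) ERM. There is a constant $C_1$ depending only on $\alpha,B,G$ such that for all $n\ge 2$ and $\delta\in(0,1)$, with probability at least $1-\delta$, every minimizer $\hat w$ over $\mathcal W$ of $P_n(w)=\frac1n\sum_{i=1}^n f(w,z_i)+\lambda\|w\|_1$ satisfies $$P(\hat w)-P_*\le C_1\,\frac{d\log n+\log(1/\delta)}{n}.$$ (3) ASA. Let $g(w,z)$ be a jointly measurable stochastic subgradient of $P$ on $\mathcal W$, i.e. $\mathbb E_z[g(w,z)]\in\partial P(w)$ (relative to $\mathcal W$) for $w\in\mathcal W$, with $\|g(w,z)\|_2\le\Gamma$ for $w\in\mathcal W$ and all $z$ ($\Gamma>0$); for instance, bounded measurable subgradients of $f(\cdot,z)+\lambda\|\cdot\|_1$ when these functions are convex. Let $w_1\in\mathcal W$ be at Euclidean distance at most $R_0$ from $\mathcal W_*$. Given $n\ge 100$, let $m=\lfloor\frac12\log_2\frac{2n}{\log_2 n}\rfloor-1$, $n_0=\lfloor n/m\rfloor$, $\hat w_0=w_1$. For $k=1,\dots,m$ let $R_{k-1}=R_0/2^{k-1}$, let $\mathcal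 W_k$ be the intersection of $\mathcal W$ with the closed Euclidean ball of center $\hat w_{k-1}$ and radius $R_{k-1}$, run $n_0$ steps $v_{t+1}=\Pi_{\mathcal W_k}(v_t-\gamma_k\, g(v_t,z_{(k-1)n_0+t}))$, $t=1,\dots,n_0$, from $v_1=\hat w_{k-1}$, with $\gamma_k=R_{k-1}/(\Gamma\sqrt{n_0+1})$, and let $\hat w_k=\frac1{n_0+1}\sum_{t=1}^{n_0+1}v_t$. There is an absolute constant $C_2$ such that for all $n\ge100$ and $\delta\in(0,1)$, with probability at least $1-\delta$, $$P(\hat w_m)-P_*\le C_2\max(\alpha\Gamma^2,R_0\Gamma)\,\frac{\log n\,\log(\log(n)/\delta)}{n}.$$ (4) ERM, non-negative smooth convex losses. Suppose in addition that there are $L\ge0$ and $\rho>0$ such that for every $z$ the function $f(\cdot,z)$ is non-negative, convex, differentiable and $L$-smooth on the set $U$ of points at Euclidean distance less than $\rho$ from $\mathcal W$, that is, $f(\cdot,z)\ge0$ on $U$ and $0\le f(w,z)-f(u,z)-\nabla f(u,z)^\top(w-u)\le\frac L2\|w-u\|_2^2$ for $w,u\in U$. There are constants $\kappa,C_3$ depending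 only on $\alpha,B,G,L,\rho$ such that for all $n\ge2$ with $n\ge\kappa\, d\log n$ and all $\delta\in(0,1)$, with probability at least $1-\delta$, every minimizer $\hat w$ of $P_n$ over $\mathcal W$ satisfies $$P(\hat w)-P_*\le C_3\left(\Big(\frac{d\log n+\log(1/\delta)}{n}\Big)^2+\frac{(d\log n+\log(1/\delta))\,P_*}{n}\right).$$ -/

import Mathlib

open MeasureTheory ProbabilityTheory

universe u v

noncomputable section

namespace L1Risk

/-- `ℝ^d` with the Euclidean norm. -/
abbrev Vec (d : ℕ) := EuclideanSpace ℝ (Fin d)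

variable {d : ℕ}

/-! ### Piecewise linear and quadratic functions -/

/-- A (closed, convex) polyhedron: the solution set of finitely many linear inequalities. -/
def IsPolyhedron (Q : Set (Vec d)) : Prop :=
  ∃ (m : ℕ) (a : Fin m → Vec d) (b : Fin m → ℝ), Q = {w | ∀ i, inner ℝ (a i) w ≤ b i}

/-- `h` is piecewise linear on `K`: finitely many polyhedra cover `K`, and `h` is affine on the part
of `K` in each of them. (As the pieces are closed, such an `h` is continuous on `K`.) -/
def IsPiecewiseLinearOn (K : Set (Vec d)) (h : Vec d → ℝ) : Prop :=
  ∃ (m : ℕ) (Q : Fin m → Set (Vec d)) (a : Fin m → Vec d) (c : Fin m → ℝ),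
    (∀ i, IsPolyhedron (Q i)) ∧ K ⊆ ⋃ i, Q i ∧
      ∀ i, ∀ w ∈ K ∩ Q i, h w = inner ℝ (a i) w + c i

/-- `h` is given on `K` by a quadratic polynomial `wᵀ A w + wᵀ b + c`. -/
def IsQuadraticOn (K : Set (Vec d)) (h : Vec d → ℝ) : Prop :=
  ∃ (A : Matrix (Fin d) (Fin d) ℝ) (b : Fin d → ℝ) (c : ℝ),
    ∀ w ∈ K, h w = w.ofLp ⬝ᵥ A.mulVec w.ofLp + w.ofLp ⬝ᵥ b + c

/-! ### The `ℓ₁`-regularized, `ℓ₁`-constrained risk minimization problem -/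

/-- The `ℓ₁` norm on `ℝ^d`. -/
def l1Norm (w : Vec d) : ℝ := ∑ i, |w i|

/-- The feasible set `{w : ‖w‖₁ ≤ B}`. -/
def l1Ball (d : ℕ) (B : ℝ) : Set (Vec d) := {w | l1Norm w ≤ B}

variable {Z : Type*} [MeasurableSpace Z]

/-- The expected loss `F(w) = E f(w, z)`, `z ∼ μ`. -/
def expectedLoss (μ : Measure Z) (f : Vec d → Z → ℝ) (w : Vec d) : ℝ := ∫ z, f w z ∂μ

/-- The regularized risk `P(w) = E f(w, z) + lam ‖w‖₁`. -/
def risk (μ : Measure Z) (f : Vec d → Z → ℝ) (lam : ℝ) (w : Vec d) : ℝ :=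
  expectedLoss μ f w + lam * l1Norm w

/-- The regularized empirical risk `P_n(w) = n⁻¹ ∑_{i < n} f(w, z_i) + lam ‖w‖₁`. -/
def empiricalRisk (f : Vec d → Z → ℝ) (lam : ℝ) (n : ℕ) (z : ℕ → Z) (w : Vec d) : ℝ :=
  (1 / (n : ℝ)) * ∑ i ∈ Finset.range n, f w (z i) + lam * l1Norm w

/-- The set of minimizers of `P` over `K`. -/
def minimizers (K : Set (Vec d)) (P : Vec d → ℝ) : Set (Vec d) :=
  {v | v ∈ K ∧ ∀ u ∈ K, P v ≤ P u}

/-- The optimal value of `P` over `K`. -/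
def optimalValue (K : Set (Vec d)) (P : Vec d → ℝ) : ℝ := sInf (P '' K)

/-- The error bound condition `EBC(θ, α)` for `min_{w ∈ K} P(w)`: every `w ∈ K` has a closest
minimizer `w'` (in Euclidean distance), and `‖w - w'‖² ≤ α (P w - P w')^θ`. -/
def EBC (K : Set (Vec d)) (P : Vec d → ℝ) (θ α : ℝ) : Prop :=
  ∀ w ∈ K, ∃ w' ∈ minimizers K P,
    (∀ u ∈ minimizers K P, ‖w' - w‖ ≤ ‖u - w‖) ∧ ‖w - w'‖ ^ 2 ≤ α * (P w - P w') ^ θ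

/-- `f(·, z)` is `G`-Lipschitz on `K` for every `z`. -/
def IsLipschitzLoss (K : Set (Vec d)) (f : Vec d → Z → ℝ) (G : ℝ) : Prop :=
  ∀ z, ∀ w ∈ K, ∀ u ∈ K, |f w z - f u z| ≤ G * ‖w - u‖

/-- For every `z`, `f(·, z)` is non-negative, differentiable, convex and `L`-smooth on the open
set `U`. -/
def IsNonnegSmoothConvexLoss (U : Set (Vec d)) (f : Vec d → Z → ℝ) (L : ℝ) : Prop :=
  ∀ z, (∀ w ∈ U, 0 ≤ f w z) ∧
    (∀ w ∈ U, DifferentiableAt ℝ (fun v => f v z) w) ∧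
    ∀ w ∈ U, ∀ u ∈ U,
      0 ≤ f w z - f u z - inner ℝ (gradient (fun v => f v z) u) (w - u) ∧
      f w z - f u z - inner ℝ (gradient (fun v => f v z) u) (w - u) ≤ L / 2 * ‖w - u‖ ^ 2

/-! ### Samples -/

/-- `ζ 0, ζ 1, …` are i.i.d. random variables with law `μ`. -/
structure IsIIDSample {Ω : Type*} [MeasurableSpace Ω] (ν : Measure Ω) (μ : Measure Z)
    (ζ : ℕ → Ω → Z) : Prop where
  measurable : ∀ i, Measurable (ζ i)
  law : ∀ i, Measure.map (ζ i) ν = μ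
  indep : iIndepFun ζ ν

/-! ### The adaptive stochastic approximation algorithm -/

/-- `g` is a stochastic subgradient oracle for `P` on `K`, with norm bound `Γ`: queried at `w ∈ K`
with a sample `z ∼ μ`, it returns a vector `g w z` with mean in the subdifferential of `P` at `w`. -/
structure IsStochasticSubgradient (K : Set (Vec d)) (μ : Measure Z) (P : Vec d → ℝ)
    (g : Vec d → Z → Vec d) (Γ : ℝ) : Prop where
  measurable : Measurable (Function.uncurry g)
  norm_le : ∀ w ∈ K, ∀ z, ‖g w z‖ ≤ Γ
  mean_mem : ∀ w ∈ K, ∀ u ∈ K, P w + inner ℝ (∫ z, g w z ∂μ) (u - w) ≤ P u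

/-- Bounded measurable selections `g w z` of the subdifferentials of the regularized random
functions `f(·, z) + lam ‖·‖₁` at `w` are stochastic subgradients of the regularized risk. -/
theorem IsStochasticSubgradient.of_pointwise {K : Set (Vec d)} {μ : Measure Z}
    [IsProbabilityMeasure μ] {f : Vec d → Z → ℝ} {lam Γ : ℝ} {g : Vec d → Z → Vec d}
    (hf : ∀ w ∈ K, Integrable (f w) μ) (hg : Measurable (Function.uncurry g))
    (hΓ : ∀ w ∈ K, ∀ z, ‖g w z‖ ≤ Γ)
    (h : ∀ z, ∀ w ∈ K, ∀ u ∈ K,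
      f w z + lam * l1Norm w + inner ℝ (g w z) (u - w) ≤ f u z + lam * l1Norm u) :
    IsStochasticSubgradient K μ (risk μ f lam) g Γ := by
  refine ⟨hg, hΓ, fun w hw u hu => ?_⟩
  have hgi : Integrable (g w) μ :=
    Integrable.of_bound (hg.comp measurable_prodMk_left).aestronglyMeasurable Γ
      (Filter.Eventually.of_forall (hΓ w hw))
  have hin : Integrable (fun z => inner ℝ (g w z) (u - w)) μ := hgi.inner_const (u - w)
  have hmean : ∫ z, inner ℝ (g w z) (u - w) ∂μ = inner ℝ (∫ z, g w z ∂μ) (u - w) := by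
    have := integral_inner (𝕜 := ℝ) hgi (u - w)
    simp_rw [real_inner_comm (u - w)]
    exact this
  have h1 : ∫ z, (f w z + inner ℝ (g w z) (u - w)) ∂μ
      ≤ ∫ z, (f u z + (lam * l1Norm u - lam * l1Norm w)) ∂μ :=
    integral_mono ((hf w hw).add hin) ((hf u hu).add (integrable_const _))
      (fun z => by have := h z w hw u hu; simp only; linarith)
  rw [integral_add (hf w hw) hin, integral_add (hf u hu) (integrable_const _), hmean] at h1
  simp only [integral_const, probReal_univ, one_smul] at h1
  simp only [risk, expectedLoss]
  linarith

open Classical in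
/-- The Euclidean projection onto `K` (the closest point of `K`; it exists and is unique for
nonempty closed convex `K`, which are the only sets it is used for). -/
def proj (K : Set (Vec d)) (x : Vec d) : Vec d :=
  if h : ∃ v ∈ K, ∀ u ∈ K, ‖v - x‖ ≤ ‖u - x‖ then h.choose else x

/-- The iterates of the projected stochastic subgradient method: `w_1 = w₁`,
`w_{t+1} = Π_K (w_t - γ g(w_t, z_t))`. Here `ssgIter … t` is `w_{t+1}`, and it uses the samples
`z 0, …, z (t - 1)`. -/
def ssgIter (g : Vec d → Z → Vec d) (K : Set (Vec d)) (γ : ℝ) (w₁ : Vec d) (z : ℕ → Z) :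
    ℕ → Vec d
  | 0 => w₁
  | t + 1 => proj K (ssgIter g K γ w₁ z t - γ • g (ssgIter g K γ w₁ z t) (z t))

/-- `SSG(w₁, γ, T, K)`: the average of `w_1, …, w_{T+1}`. -/
def ssg (g : Vec d → Z → Vec d) (K : Set (Vec d)) (γ : ℝ) (w₁ : Vec d) (z : ℕ → Z) (T : ℕ) :
    Vec d :=
  (1 / ((T : ℝ) + 1)) • ∑ t ∈ Finset.range (T + 1), ssgIter g K γ w₁ z t

/-- The number of stages, `m = ⌊½ log₂ (2n / log₂ n)⌋ - 1`. -/
def asaStages (n : ℕ) : ℕ :=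
  ⌊(1 / 2 : ℝ) * Real.logb 2 (2 * (n : ℝ) / Real.logb 2 (n : ℝ))⌋₊ - 1

/-- The number of iterations per stage, `n₀ = ⌊n / m⌋`. -/
def asaStageLength (n : ℕ) : ℕ := n / asaStages n

/-- The point `ŵ_k` after `k` stages: stage `k + 1` runs `SSG` from `ŵ_k` for `n₀` iterations with
step size `R_k / (Γ √(n₀ + 1))` on `K ∩ closedBall ŵ_k R_k`, where `R_k = R₀ / 2 ^ k`, on the next
`n₀` samples. -/
def asaIter (g : Vec d → Z → Vec d) (K : Set (Vec d)) (Γ R₀ : ℝ) (w₁ : Vec d) (n₀ : ℕ)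
    (z : ℕ → Z) : ℕ → Vec d
  | 0 => w₁
  | k + 1 =>
      ssg g (K ∩ Metric.closedBall (asaIter g K Γ R₀ w₁ n₀ z k) (R₀ / 2 ^ k))
        (R₀ / 2 ^ k / (Γ * Real.sqrt ((n₀ : ℝ) + 1))) (asaIter g K Γ R₀ w₁ n₀ z k)
        (fun t => z (k * n₀ + t)) n₀

/-- The output of `ASA(w₁, n, R₀)`; it makes one pass over (at most) the `n` samples
`z 0, …, z (n - 1)`. -/
def asa (g : Vec d → Z → Vec d) (K : Set (Vec d)) (Γ R₀ : ℝ) (w₁ : Vec d) (n : ℕ) (z : ℕ → Z) :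
    Vec d :=
  asaIter g K Γ R₀ w₁ (asaStageLength n) z (asaStages n)

end L1Risk

end

open L1Risk

noncomputable section

namespace L1Risk

variable {d : ℕ}

/-! ### The `ℓ₁` ball -/

/-! Error bound. On each orthant the ℓ₁ norm is linear, so convexity of `P` forces a quadratic `F`
to have a nonnegative quadratic form (`quadraticForm_nonneg_of_convexOn`). In both cases the ball
therefore splits into finitely many polyhedra on which `P` is a sum of squares plus an affine
function. The minimizers over such a piece are cut out of it by linear conditions. Hoffman's lemma
bounds the distance to them by the residuals of these conditions, and on a bounded piece the squared
residuals are controlled by the gap in value (`exists_growth_of_convexQuadratic`). On a piece that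
misses the global minimum the gap is bounded below, which suffices because the ball is bounded.

Empirical risk minimization. The excess risk of an empirical minimizer `w` over its closest true
minimizer `v` is at most the deviation of the empirical mean of `f w - f v` from its expectation.
Since `v` varies with `w`, Bernstein's inequality is applied to all pairs of points of a net of
radius `B / n²`. The second moment is at most `G² ‖w - v‖²`, hence by the error bound at most `α G²`
times the excess risk; the variance term is thus absorbed on the left and only a term of order `1 /
n` survives. For non-negative smooth losses the second moment is of order `‖w - v‖² F(v) + ‖w - v‖⁴`
(`sq_sub_le_of_smooth`) with `F(v) ≤ P_*`, and the same absorption gives the optimistic rate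
(`excess_le_of_self_bounding`).

Stochastic approximation. A stage of radius `R` has excess `O(Γ R / √n₀)` over every point of its
domain, up to a martingale term handled by an Azuma inequality (`ssg_sub_le`,
`IsStochasticSubgradient.measure_noise_ge_le`). By the error bound, while `R` is large a stage ends
within `R / 2` of a minimizer, so the radius may be halved. Once `R` is too small for this, the
excess is already of the final order, and later stages can increase it only by a geometric series
(`excess_risk_le_of_stages`). -/

lemma l1Norm_nonneg (w : Vec d) : 0 ≤ l1Norm w := Finset.sum_nonneg fun _ _ => abs_nonneg _

lemma norm_le_l1Norm (w : Vec d) : ‖w‖ ≤ l1Norm w := by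
  rw [EuclideanSpace.norm_eq]
  refine Real.sqrt_le_iff.2 ⟨l1Norm_nonneg w, ?_⟩
  simp only [Real.norm_eq_abs]
  exact Finset.sum_sq_le_sq_sum_of_nonneg fun _ _ => abs_nonneg _

lemma continuous_l1Norm : Continuous (l1Norm : Vec d → ℝ) := by
  unfold l1Norm
  fun_prop

lemma norm_le_of_mem_l1Ball {B : ℝ} {w : Vec d} (hw : w ∈ l1Ball d B) : ‖w‖ ≤ B :=
  (norm_le_l1Norm w).trans hw

lemma norm_sub_le_of_mem_l1Ball {B : ℝ} {w u : Vec d} (hw : w ∈ l1Ball d B)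
    (hu : u ∈ l1Ball d B) : ‖w - u‖ ≤ 2 * B :=
  (norm_sub_le w u).trans (by linarith [norm_le_of_mem_l1Ball hw, norm_le_of_mem_l1Ball hu])

lemma zero_mem_l1Ball {B : ℝ} (hB : 0 ≤ B) : (0 : Vec d) ∈ l1Ball d B := by
  simpa [l1Ball, l1Norm] using hB

lemma isClosed_l1Ball (B : ℝ) : IsClosed (l1Ball d B) :=
  isClosed_le continuous_l1Norm continuous_const

lemma isCompact_l1Ball (B : ℝ) : IsCompact (l1Ball d B) :=
  (isCompact_closedBall (0 : Vec d) B).of_isClosed_subset (isClosed_l1Ball B) fun w hw => by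
    simpa using norm_le_of_mem_l1Ball hw

lemma optimalValue_eq {K : Set (Vec d)} {P : Vec d → ℝ} {v : Vec d} (hv : v ∈ minimizers K P) :
    optimalValue K P = P v :=
  IsLeast.csInf_eq ⟨⟨v, hv.1, rfl⟩, by rintro _ ⟨u, hu, rfl⟩; exact hv.2 u hu⟩

/-! ### Projections onto closed convex sets -/

section Projection

variable {K : Set (Vec d)}

lemma exists_closest_point (hc : IsClosed K) (hne : K.Nonempty) (x : Vec d) :
    ∃ v ∈ K, ∀ u ∈ K, ‖v - x‖ ≤ ‖u - x‖ := by
  obtain ⟨v, hv, h⟩ := hc.exists_infDist_eq_dist hne x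
  refine ⟨v, hv, fun u hu => ?_⟩
  rw [norm_sub_rev, ← dist_eq_norm, ← h, norm_sub_rev, ← dist_eq_norm]
  exact Metric.infDist_le_dist_of_mem hu

lemma inner_le_zero_of_closest (hK : Convex ℝ K) {x v : Vec d} (hv : v ∈ K)
    (h : ∀ u ∈ K, ‖v - x‖ ≤ ‖u - x‖) {u : Vec d} (hu : u ∈ K) :
    inner ℝ (x - v) (u - v) ≤ 0 := by
  refine (norm_eq_iInf_iff_real_inner_le_zero hK hv).1 ?_ u hu
  have : Nonempty K := ⟨⟨v, hv⟩⟩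
  refine le_antisymm (le_ciInf fun w => ?_) (ciInf_le ⟨0, ?_⟩ (⟨v, hv⟩ : K))
  · rw [norm_sub_rev, norm_sub_rev x]; exact h w w.2
  · rintro _ ⟨w, rfl⟩; exact norm_nonneg _

lemma proj_spec (hc : IsClosed K) (hne : K.Nonempty) (x : Vec d) :
    proj K x ∈ K ∧ ∀ u ∈ K, ‖proj K x - x‖ ≤ ‖u - x‖ := by
  have h := exists_closest_point hc hne x
  rw [proj, dif_pos h]
  exact h.choose_spec

lemma proj_mem (hc : IsClosed K) (hne : K.Nonempty) (x : Vec d) : proj K x ∈ K :=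
  (proj_spec hc hne x).1

lemma inner_sub_proj_le (hK : Convex ℝ K) (hc : IsClosed K) {u : Vec d} (hu : u ∈ K) (x : Vec d) :
    inner ℝ (x - proj K x) (u - proj K x) ≤ 0 :=
  inner_le_zero_of_closest hK (proj_spec hc ⟨u, hu⟩ x).1 (proj_spec hc ⟨u, hu⟩ x).2 hu

lemma proj_eq_self (hc : IsClosed K) {x : Vec d} (hx : x ∈ K) : proj K x = x := by
  have h := (proj_spec hc ⟨x, hx⟩ x).2 x hx
  simpa [sub_eq_zero] using h

lemma norm_proj_sub_le (hK : Convex ℝ K) (hc : IsClosed K) {u : Vec d} (hu : u ∈ K) (x : Vec d) :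
    ‖proj K x - u‖ ^ 2 ≤ ‖x - u‖ ^ 2 := by
  have h := inner_sub_proj_le hK hc hu x
  have e : ‖x - u‖ ^ 2 = ‖x - proj K x‖ ^ 2 - 2 * inner ℝ (x - proj K x) (u - proj K x)
      + ‖proj K x - u‖ ^ 2 := by
    rw [← norm_sub_rev u (proj K x), ← norm_sub_sq_real]
    congr 2; abel
  nlinarith [sq_nonneg ‖x - proj K x‖]

lemma lipschitzWith_proj (hK : Convex ℝ K) (hc : IsClosed K) (hne : K.Nonempty) :
    LipschitzWith 1 (proj K) := by
  refine LipschitzWith.of_dist_le_mul fun x y => ?_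
  simp only [NNReal.coe_one, one_mul, dist_eq_norm]
  have h1 := inner_sub_proj_le hK hc (proj_mem hc hne y) x
  have h2 := inner_sub_proj_le hK hc (proj_mem hc hne x) y
  set p := proj K x
  set q := proj K y
  have e : inner ℝ (x - p) (q - p) + inner ℝ (y - q) (p - q)
      = inner ℝ (p - q) (p - q) - inner ℝ (x - y) (p - q) := by
    simp only [inner_sub_left, inner_sub_right]; ring
  rw [real_inner_self_eq_norm_sq] at e
  have h3 := real_inner_le_norm (x - y) (p - q)
  by_contra! h
  nlinarith [norm_nonneg (x - y), norm_nonneg (p - q)]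

end Projection

/-! ### Hoffman's error bound for systems of linear inequalities -/

section Hoffman

variable {ι : Type*}

lemma isClosed_setOf_inner_le (a : ι → Vec d) (b : ι → ℝ) :
    IsClosed {w : Vec d | ∀ i, inner ℝ (a i) w ≤ b i} := by
  simp only [Set.ofPred_forall]
  exact isClosed_iInter fun i => isClosed_le (by fun_prop) continuous_const

lemma convex_setOf_inner_le (a : ι → Vec d) (b : ι → ℝ) :
    Convex ℝ {w : Vec d | ∀ i, inner ℝ (a i) w ≤ b i} := by
  simp only [Set.ofPred_forall]
  exact convex_iInter fun i => convex_halfSpace_le (innerSL ℝ (a i)).isLinear _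

/-- On unit vectors of the polar of the cone `{v : ⟪a i, v⟫ ≤ 0, i ∈ I}`, the residuals of the
inequalities `⟪a i, v⟫ ≤ 0` are bounded below. -/
lemma exists_residual_lower_bound (a : ι → Vec d) (I : Finset ι) :
    ∃ c > 0, ∀ u : Vec d, ‖u‖ = 1 →
      (∀ v, (∀ i ∈ I, inner ℝ (a i) v ≤ 0) → inner ℝ u v ≤ 0) →
      c ≤ ∑ i ∈ I, max 0 (inner ℝ (a i) u) := by
  set C : Set (Vec d) := Metric.sphere 0 1 ∩
    {u | ∀ v, (∀ i ∈ I, inner ℝ (a i) v ≤ 0) → inner ℝ u v ≤ 0} with hC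
  have hcomp : IsCompact C := by
    refine (isCompact_sphere _ _).inter_right ?_
    simp only [Set.ofPred_forall]
    exact isClosed_iInter fun v => isClosed_iInter fun _ =>
      isClosed_le (by fun_prop) continuous_const
  rcases C.eq_empty_or_nonempty with he | hne
  · refine ⟨1, one_pos, fun u hu hp => ?_⟩
    have : u ∈ C := ⟨by simpa using hu, hp⟩
    simp [he] at this
  · have hcont : Continuous fun u : Vec d => ∑ i ∈ I, max 0 (inner ℝ (a i) u) := by fun_prop
    obtain ⟨u₀, hu₀, hmin⟩ := hcomp.exists_isMinOn hne hcont.continuousOn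
    refine ⟨_, ?_, fun u hu hp => hmin (⟨by simpa using hu, hp⟩ : u ∈ C)⟩
    by_contra! hle
    have hz : ∀ i ∈ I, max 0 (inner ℝ (a i) u₀) = 0 :=
      (Finset.sum_eq_zero_iff_of_nonneg fun i _ => le_max_left _ _).1
        (le_antisymm hle (Finset.sum_nonneg fun i _ => le_max_left _ _))
    -- If all residuals vanish, `u₀` lies both in the cone and in its polar, hence is orthogonal to
    -- itself, although it is a unit vector.
    have h := hu₀.2 u₀ fun i hi => max_eq_left_iff.1 (hz i hi)
    have h1 : ‖u₀‖ = 1 := by simpa using hu₀.1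
    rw [real_inner_self_eq_norm_sq, h1] at h
    norm_num at h

/-- **Hoffman's lemma**: the distance to a nonempty polyhedron is at most a constant times the sum
of the residuals of its defining inequalities. -/
theorem exists_hoffman_bound [Fintype ι] (a : ι → Vec d) (b : ι → ℝ)
    (hne : {w : Vec d | ∀ i, inner ℝ (a i) w ≤ b i}.Nonempty) :
    ∃ H > 0, ∀ w, ∃ p, (∀ i, inner ℝ (a i) p ≤ b i) ∧
      ‖w - p‖ ≤ H * ∑ i, max 0 (inner ℝ (a i) w - b i) := by
  classical
  choose c hc0 hc using exists_residual_lower_bound a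
  -- The set of active inequalities depends on the point, but it is one of finitely many subsets;
  -- summing over all of them gives a uniform constant.
  have hH : 0 < ∑ I, (c I)⁻¹ := Finset.sum_pos (fun I _ => inv_pos.2 (hc0 I)) ⟨∅, by simp⟩
  refine ⟨∑ I, (c I)⁻¹, hH, fun w => ?_⟩
  obtain ⟨p, hp, hclose⟩ := exists_closest_point (isClosed_setOf_inner_le a b) hne w
  refine ⟨p, hp, ?_⟩
  have hsum : ∀ I : Finset ι, 0 ≤ ∑ i ∈ I, max 0 (inner ℝ (a i) w - b i) := fun I =>
    Finset.sum_nonneg fun i _ => le_max_left _ _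
  rcases eq_or_ne w p with rfl | hwp
  · simpa using mul_nonneg hH.le (hsum _)
  have hr : 0 < ‖w - p‖ := norm_pos_iff.2 (sub_ne_zero.2 hwp)
  set I : Finset ι := Finset.univ.filter fun i => inner ℝ (a i) p = b i
  -- A small move from `p` in a direction permitted by the active inequalities stays feasible, so
  -- the variational inequality of the projection puts `w - p` in the polar of the cone of these
  -- directions.
  have hpolar : ∀ v, (∀ i ∈ I, inner ℝ (a i) v ≤ 0) → inner ℝ (w - p) v ≤ 0 := by
    intro v hv
    have hev : ∀ᶠ t : ℝ in nhdsWithin 0 (Set.Ioi 0), ∀ i, inner ℝ (a i) (p + t • v) ≤ b i := by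
      refine Filter.eventually_all.2 fun i => ?_
      by_cases hi : inner ℝ (a i) p = b i
      · filter_upwards [self_mem_nhdsWithin] with t ht
        rw [inner_add_right, inner_smul_right, hi]
        have := mul_nonpos_of_nonneg_of_nonpos (le_of_lt ht) (hv i (by simp [I, hi]))
        linarith
      · have hlt : inner ℝ (a i) (p + (0 : ℝ) • v) < b i := by
          simpa using lt_of_le_of_ne (hp i) hi
        have hcont : Continuous fun t : ℝ => inner ℝ (a i) (p + t • v) := by fun_prop
        exact nhdsWithin_le_nhds ((hcont.tendsto 0).eventually (eventually_le_nhds hlt))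
    obtain ⟨t, hmem, ht⟩ := (hev.and self_mem_nhdsWithin).exists
    have h := inner_le_zero_of_closest (convex_setOf_inner_le a b) hp hclose hmem
    rw [add_sub_cancel_left, inner_smul_right] at h
    exact nonpos_of_mul_nonpos_right h ht
  have h := hc I (‖w - p‖⁻¹ • (w - p)) (norm_smul_inv_norm (sub_ne_zero.2 hwp)) fun v hv => by
    rw [real_inner_smul_left]
    exact mul_nonpos_of_nonneg_of_nonpos (by positivity) (hpolar v hv)
  have hres : ∑ i ∈ I, max 0 (inner ℝ (a i) (‖w - p‖⁻¹ • (w - p)))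
      = ‖w - p‖⁻¹ * ∑ i ∈ I, max 0 (inner ℝ (a i) w - b i) := by
    rw [Finset.mul_sum]
    refine Finset.sum_congr rfl fun i hi => ?_
    have hi' : inner ℝ (a i) p = b i := by simpa [I] using hi
    rw [inner_smul_right, inner_sub_right, hi', mul_max_of_nonneg _ _ (by positivity), mul_zero]
  rw [hres, ← div_eq_inv_mul, le_div_iff₀ hr] at h
  calc ‖w - p‖ = (c I)⁻¹ * (c I * ‖w - p‖) := by rw [inv_mul_cancel_left₀ (hc0 I).ne']
    _ ≤ (c I)⁻¹ * ∑ i ∈ I, max 0 (inner ℝ (a i) w - b i) := by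
      have := hc0 I
      gcongr
    _ ≤ (∑ I, (c I)⁻¹) * ∑ i, max 0 (inner ℝ (a i) w - b i) := by
      refine mul_le_mul ?_ ?_ (hsum I) hH.le
      · exact Finset.single_le_sum (f := fun I => (c I)⁻¹)
          (fun I _ => (inv_pos.2 (hc0 I)).le) (Finset.mem_univ I)
      · exact Finset.sum_le_sum_of_subset_of_nonneg (Finset.subset_univ I)
          fun i _ _ => le_max_left _ _

end Hoffman

/-! ### Quadratic growth of piecewise convex quadratic functions -/

/-- The convex quadratic function `w ↦ ∑ k, ⟪e k, w⟫² + ⟪g, w⟫ + c`. -/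
def convexQuadratic (e : Fin d → Vec d) (g : Vec d) (c : ℝ) (w : Vec d) : ℝ :=
  ∑ k, inner ℝ (e k) w ^ 2 + inner ℝ g w + c

lemma continuous_convexQuadratic (e : Fin d → Vec d) (g : Vec d) (c : ℝ) :
    Continuous (convexQuadratic e g c) := by
  unfold convexQuadratic
  fun_prop

/-- Quadratic growth of a convex quadratic function on a bounded polyhedron. -/
lemma exists_growth_of_convexQuadratic {S : Set (Vec d)} (hS : IsPolyhedron S) (e : Fin d → Vec d)
    (g : Vec d) (c : ℝ) {x : Vec d} (hx : x ∈ S)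
    (hmin : ∀ w ∈ S, convexQuadratic e g c x ≤ convexQuadratic e g c w)
    {D : ℝ} (hD : ∀ w ∈ S, ‖w - x‖ ≤ D) :
    ∃ α > 0, ∀ w ∈ S, ∃ p ∈ S, convexQuadratic e g c p = convexQuadratic e g c x ∧
      ‖w - p‖ ^ 2 ≤ α * (convexQuadratic e g c w - convexQuadratic e g c x) := by
  obtain ⟨m, a, b, rfl⟩ := hS
  set S : Set (Vec d) := {w | ∀ i, inner ℝ (a i) w ≤ b i} with hSdef
  set q := convexQuadratic e g c with hq
  -- The gradient at `x`: the increment from `x` is then a sum of squares plus a linear form, which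
  -- is nonnegative on feasible increments.
  set G : Vec d := g + ∑ k, (2 * inner ℝ (e k) x) • e k with hG
  have hD0 : 0 ≤ D := (norm_nonneg _).trans (hD x hx)
  have hexp : ∀ h : Vec d, q (x + h) - q x = ∑ k, inner ℝ (e k) h ^ 2 + inner ℝ G h := by
    intro h
    have : ∑ k, (inner ℝ (e k) x + inner ℝ (e k) h) ^ 2
        = ∑ k, inner ℝ (e k) x ^ 2 + ∑ k, 2 * inner ℝ (e k) x * inner ℝ (e k) h
          + ∑ k, inner ℝ (e k) h ^ 2 := by
      rw [← Finset.sum_add_distrib, ← Finset.sum_add_distrib]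
      exact Finset.sum_congr rfl fun k _ => by ring
    simp only [hq, convexQuadratic, inner_add_right, hG, inner_add_left, sum_inner,
      real_inner_smul_left, this]
    ring
  have hexp' : ∀ w, q w - q x = ∑ k, inner ℝ (e k) (w - x) ^ 2 + inner ℝ G (w - x) := fun w => by
    rw [← hexp, add_sub_cancel]
  have hfirst : ∀ w ∈ S, 0 ≤ inner ℝ G (w - x) := by
    intro w hw
    by_contra! hneg
    set s := ∑ k, inner ℝ (e k) (w - x) ^ 2
    have hs : 0 ≤ s := Finset.sum_nonneg fun _ _ => sq_nonneg _
    set γ := inner ℝ G (w - x)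
    -- For this `t` the quadratic term is at most half the size of the negative linear term, so the
    -- segment from `x` to `w` would contain a point of smaller value.
    set t : ℝ := min 1 (-γ / (2 * (s + 1)))
    have ht0 : 0 < t := lt_min one_pos (div_pos (by linarith) (by linarith))
    have ht1 : t ≤ 1 := min_le_left _ _
    have ht2 : t * (2 * (s + 1)) ≤ -γ := by
      rw [← le_div_iff₀ (by linarith)]; exact min_le_right _ _
    have hmem : x + t • (w - x) ∈ S :=
      (convex_setOf_inner_le a b).add_smul_sub_mem hx hw ⟨ht0.le, ht1⟩
    have h1 := hmin _ hmem
    have h2 := hexp (t • (w - x))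
    simp only [inner_smul_right, mul_pow, ← Finset.mul_sum] at h2
    have h3 : 0 ≤ t * (t * s + γ) := by nlinarith
    have h4 : 0 ≤ t * s + γ := nonneg_of_mul_nonneg_right h3 ht0
    nlinarith
  -- Linear description of the minimizers in `S`: the forms `e k` take their values at `x` (each
  -- equation written as two inequalities) and `G` does not increase.
  let a' : Fin m ⊕ Fin d ⊕ Fin d ⊕ Unit → Vec d :=
    Sum.elim a (Sum.elim e (Sum.elim (fun k => -e k) fun _ => G))
  let b' : Fin m ⊕ Fin d ⊕ Fin d ⊕ Unit → ℝ :=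
    Sum.elim b (Sum.elim (fun k => inner ℝ (e k) x)
      (Sum.elim (fun k => -inner ℝ (e k) x) fun _ => inner ℝ G x))
  obtain ⟨H, hH, hoff⟩ := exists_hoffman_bound a' b' ⟨x, by
    rintro (i | i | i | i)
    · exact hx i
    all_goals simp [a', b']⟩
  refine ⟨H ^ 2 * (2 * (d + ‖G‖ * D) + 1), by positivity, fun w hw => ?_⟩
  obtain ⟨p, hp, hdist⟩ := hoff w
  have hpS : p ∈ S := fun i => hp (Sum.inl i)
  have hpe : ∀ k, inner ℝ (e k) (p - x) = 0 := fun k => by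
    have h1 := hp (Sum.inr (Sum.inl k))
    have h2 := hp (Sum.inr (Sum.inr (Sum.inl k)))
    simp only [a', b', Sum.elim_inr, Sum.elim_inl, inner_neg_left] at h1 h2
    rw [inner_sub_right]; linarith
  have hpG : inner ℝ G (p - x) ≤ 0 := by
    have h1 := hp (Sum.inr (Sum.inr (Sum.inr ())))
    simp only [a', b', Sum.elim_inr] at h1
    rw [inner_sub_right]; linarith
  refine ⟨p, hpS, le_antisymm ?_ (hmin p hpS), ?_⟩
  · have h := hexp' p
    simp only [hpe] at h
    norm_num at h
    linarith
  set s := ∑ k, inner ℝ (e k) (w - x) ^ 2 with hs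
  set γ := inner ℝ G (w - x) with hγ
  have hγ0 : 0 ≤ γ := hfirst w hw
  have hs0 : 0 ≤ s := Finset.sum_nonneg fun _ _ => sq_nonneg _
  have hγle : γ ≤ ‖G‖ * D :=
    (real_inner_le_norm _ _).trans (mul_le_mul_of_nonneg_left (hD w hw) (norm_nonneg _))
  have hres : ∑ i, max 0 (inner ℝ (a' i) w - b' i) = ∑ k, |inner ℝ (e k) (w - x)| + γ := by
    simp only [Fintype.sum_sum_type, a', b', Sum.elim_inl, Sum.elim_inr, Finset.univ_unique,
      Finset.sum_singleton]
    have h1 : ∑ i, max 0 (inner ℝ (a i) w - b i) = 0 :=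
      Finset.sum_eq_zero fun i _ => max_eq_left (by linarith [hw i])
    have h2 : max 0 (inner ℝ G w - inner ℝ G x) = γ := by
      rw [← inner_sub_right]; exact max_eq_right hγ0
    rw [h1, h2, zero_add, ← add_assoc, ← Finset.sum_add_distrib]
    congr 1
    refine Finset.sum_congr rfl fun k _ => ?_
    rw [inner_neg_left, inner_sub_right]
    rcases le_total 0 (inner ℝ (e k) w - inner ℝ (e k) x) with h | h
    · rw [max_eq_right h, max_eq_left (by linarith), abs_of_nonneg h, add_zero]
    · rw [max_eq_left h, max_eq_right (by linarith), abs_of_nonpos h]; ring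
  -- The squared residual has to be bounded by `s + γ`. Cauchy–Schwarz handles the absolute values;
  -- for the linear part, `γ² ≤ ‖G‖ D γ` because the piece is bounded.
  have hcs : (∑ k, |inner ℝ (e k) (w - x)|) ^ 2 ≤ d * s := by
    have := sq_sum_le_card_mul_sum_sq (s := (Finset.univ : Finset (Fin d)))
      (f := fun k => |inner ℝ (e k) (w - x)|)
    simpa [sq_abs] using this
  rw [hres] at hdist
  rw [hexp' w]
  set r := ∑ k, |inner ℝ (e k) (w - x)|
  have hGD : 0 ≤ ‖G‖ * D := by positivity
  calc ‖w - p‖ ^ 2 ≤ (H * (r + γ)) ^ 2 := by gcongr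
    _ = H ^ 2 * (r + γ) ^ 2 := by ring
    _ ≤ H ^ 2 * ((2 * (d + ‖G‖ * D) + 1) * (s + γ)) := by
      gcongr
      have hd : (0 : ℝ) ≤ d := by positivity
      nlinarith [sq_nonneg (r - γ), mul_nonneg hd hγ0, mul_nonneg hGD hs0,
        mul_le_mul_of_nonneg_right hγle hγ0]
    _ = _ := by ring

lemma isPolyhedron_of_fintype {ι : Type*} [Fintype ι] (a : ι → Vec d) (b : ι → ℝ) :
    IsPolyhedron {w : Vec d | ∀ i, inner ℝ (a i) w ≤ b i} := by
  let φ := Fintype.equivFin ι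
  refine ⟨Fintype.card ι, a ∘ φ.symm, b ∘ φ.symm, ?_⟩
  ext w
  exact (φ.symm.forall_congr_right (q := fun i => inner ℝ (a i) w ≤ b i)).symm

lemma IsPolyhedron.inter {S T : Set (Vec d)} (hS : IsPolyhedron S) (hT : IsPolyhedron T) :
    IsPolyhedron (S ∩ T) := by
  obtain ⟨m, a, b, rfl⟩ := hS
  obtain ⟨n, a', b', rfl⟩ := hT
  convert isPolyhedron_of_fintype (Sum.elim a a') (Sum.elim b b') using 1
  ext w
  simp

lemma IsPolyhedron.isClosed {S : Set (Vec d)} (hS : IsPolyhedron S) : IsClosed S := by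
  obtain ⟨m, a, b, rfl⟩ := hS
  exact isClosed_setOf_inner_le a b

/-- Finitely many polyhedra cover `K`, and on the part of `K` in each of them `F` is a convex
quadratic function. -/
def IsPiecewiseConvexQuadraticOn (K : Set (Vec d)) (F : Vec d → ℝ) : Prop :=
  ∃ (m : ℕ) (Q : Fin m → Set (Vec d)) (e : Fin m → Fin d → Vec d) (g : Fin m → Vec d)
    (c : Fin m → ℝ), (∀ i, IsPolyhedron (Q i)) ∧ K ⊆ ⋃ i, Q i ∧
      ∀ i, ∀ w ∈ K ∩ Q i, F w = convexQuadratic (e i) (g i) (c i) w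

/-- A function that is convex quadratic on each of finitely many polyhedra with compact nonempty
union `K` satisfies the error bound condition on `K`. -/
theorem exists_EBC_of_pieces {ι : Type*} [Fintype ι] {K : Set (Vec d)} (hK : IsCompact K)
    (hne : K.Nonempty) {P : Vec d → ℝ} {S : ι → Set (Vec d)} (hS : ∀ i, IsPolyhedron (S i))
    (hcover : K = ⋃ i, S i) {e : ι → Fin d → Vec d} {g : ι → Vec d} {c : ι → ℝ}
    (hP : ∀ i, ∀ w ∈ S i, P w = convexQuadratic (e i) (g i) (c i) w) :
    ∃ α : ℝ, 0 < α ∧ EBC K P 1 α := by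
  classical
  have hSK : ∀ i, S i ⊆ K := fun i => by rw [hcover]; exact Set.subset_iUnion S i
  have hSc : ∀ i, IsCompact (S i) := fun i => hK.of_isClosed_subset (hS i).isClosed (hSK i)
  have hcont : ∀ i, ContinuousOn P (S i) := fun i =>
    (continuous_convexQuadratic (e i) (g i) (c i)).continuousOn.congr (hP i)
  have hminim : ∀ i, (S i).Nonempty → ∃ x ∈ S i, ∀ w ∈ S i, P x ≤ P w := fun i hi =>
    (hSc i).exists_isMinOn hi (hcont i)
  obtain ⟨v, hv⟩ : (minimizers K P).Nonempty := by
    set J : Finset ι := Finset.univ.filter fun i => (S i).Nonempty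
    choose! x hx hxmin using hminim
    obtain ⟨w₀, hw₀⟩ := hne
    obtain ⟨i₀, hi₀⟩ := Set.mem_iUnion.1 (hcover ▸ hw₀)
    obtain ⟨j, hj, hjmin⟩ := J.exists_min_image (fun i => P (x i))
      ⟨i₀, by simpa [J] using ⟨w₀, hi₀⟩⟩
    have hj' : (S j).Nonempty := by simpa [J] using hj
    refine ⟨x j, hSK j (hx j hj'), fun u hu => ?_⟩
    obtain ⟨i, hi⟩ := Set.mem_iUnion.1 (hcover ▸ hu)
    have hi' : (S i).Nonempty := ⟨u, hi⟩
    exact (hjmin i (by simpa [J] using hi')).trans (hxmin i hi' u hi)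
  have hval : ∀ u ∈ minimizers K P, P u = P v := fun u hu =>
    le_antisymm (hu.2 v hv.1) (hv.2 u hu.1)
  have hclosed : IsClosed (minimizers K P) := by
    have : minimizers K P = ⋃ i, S i ∩ {w | convexQuadratic (e i) (g i) (c i) w ≤ P v} := by
      ext w
      simp only [Set.mem_iUnion, Set.mem_inter_iff, Set.mem_ofPred_eq]
      constructor
      · intro hw
        obtain ⟨i, hi⟩ := Set.mem_iUnion.1 (hcover ▸ hw.1)
        exact ⟨i, hi, by rw [← hP i w hi]; exact hw.2 v hv.1⟩
      · rintro ⟨i, hi, hle⟩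
        rw [← hP i w hi] at hle
        exact ⟨hSK i hi, fun u hu => hle.trans (hv.2 u hu)⟩
    rw [this]
    exact isClosed_iUnion_of_finite fun i => (hS i).isClosed.inter
      (isClosed_le (continuous_convexQuadratic _ _ _) continuous_const)
  obtain ⟨D, hD⟩ := hK.isBounded.exists_norm_le
  have hdiam : ∀ w ∈ K, ∀ u ∈ K, ‖w - u‖ ≤ 2 * D := fun w hw u hu =>
    (norm_sub_le w u).trans (by linarith [hD w hw, hD u hu])
  have hpiece : ∀ i, ∃ α > 0, ∀ w ∈ S i, ∃ p ∈ minimizers K P, ‖w - p‖ ^ 2 ≤ α * (P w - P v) := by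
    intro i
    rcases (S i).eq_empty_or_nonempty with hi | hi
    · exact ⟨1, one_pos, by simp [hi]⟩
    obtain ⟨x, hx, hxmin⟩ := hminim i hi
    -- Either the piece attains the global minimum and its own minimizers are global ones, or its
    -- values exceed the minimum by a fixed gap and any constant above diameter squared over gap
    -- works.
    rcases (hv.2 x (hSK i hx)).eq_or_lt with heq | hlt
    · obtain ⟨α, hα, h⟩ := exists_growth_of_convexQuadratic (hS i) (e i) (g i) (c i) hx
        (fun w hw => by rw [← hP i w hw, ← hP i x hx]; exact hxmin w hw)
        (fun w hw => hdiam w (hSK i hw) x (hSK i hx))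
      refine ⟨α, hα, fun w hw => ?_⟩
      obtain ⟨p, hp, hpx, hle⟩ := h w hw
      rw [← hP i x hx, ← hP i w hw, ← heq] at hle
      rw [← hP i x hx, ← hP i p hp] at hpx
      exact ⟨p, ⟨hSK i hp, fun u hu => by rw [hpx, ← heq]; exact hv.2 u hu⟩, hle⟩
    · have hgap : 0 < P x - P v := sub_pos.2 hlt
      refine ⟨((2 * D) ^ 2 + 1) / (P x - P v), by positivity, fun w hw => ⟨v, hv, ?_⟩⟩
      have h1 : P x - P v ≤ P w - P v := by linarith [hxmin w hw]
      calc ‖w - v‖ ^ 2 ≤ (2 * D) ^ 2 + 1 := by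
            have := hdiam w (hSK i hw) v hv.1
            nlinarith [norm_nonneg (w - v)]
        _ = ((2 * D) ^ 2 + 1) / (P x - P v) * (P x - P v) := by field_simp
        _ ≤ _ := by gcongr
  choose α hα hgrow using hpiece
  have hsum : 0 ≤ ∑ i, α i := Finset.sum_nonneg fun i _ => (hα i).le
  refine ⟨∑ i, α i + 1, by linarith, fun w hw => ?_⟩
  obtain ⟨w', hw', hclose⟩ := exists_closest_point hclosed ⟨v, hv⟩ w
  refine ⟨w', hw', hclose, ?_⟩
  obtain ⟨i, hi⟩ := Set.mem_iUnion.1 (hcover ▸ hw)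
  obtain ⟨p, hp, hle⟩ := hgrow i w hi
  rw [Real.rpow_one, hval w' hw']
  have h0 : 0 ≤ P w - P v := sub_nonneg.2 (hv.2 w hw)
  have h1 : ‖w - w'‖ ≤ ‖w - p‖ := by
    rw [norm_sub_rev, norm_sub_rev w p]; exact hclose p hp
  calc ‖w - w'‖ ^ 2 ≤ ‖w - p‖ ^ 2 := by gcongr
    _ ≤ α i * (P w - P v) := hle
    _ ≤ (∑ i, α i + 1) * (P w - P v) := by
      gcongr
      have := Finset.single_le_sum (f := α) (fun j _ => (hα j).le) (Finset.mem_univ i)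
      linarith

/-! ### The error bound condition for quadratic and piecewise linear risks -/

/-- The vector of signs `±1` that `σ` describes. -/
def signVec (σ : Fin d → Bool) : Vec d := WithLp.toLp 2 fun i => if σ i then 1 else -1

/-- The part of the `ℓ₁` ball in the closed orthant with signs `σ`. -/
def orthantPart (B : ℝ) (σ : Fin d → Bool) : Set (Vec d) :=
  {w | (∀ i, 0 ≤ signVec σ i * w i) ∧ inner ℝ (signVec σ) w ≤ B}

lemma isPolyhedron_orthantPart (B : ℝ) (σ : Fin d → Bool) : IsPolyhedron (orthantPart B σ) := by
  convert isPolyhedron_of_fintype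
    (Sum.elim (fun i => EuclideanSpace.single i (-signVec σ i)) fun _ : Unit => signVec σ)
    (Sum.elim (fun _ => 0) fun _ => B) using 1
  ext w
  simp [orthantPart, EuclideanSpace.inner_single_left]

lemma l1Norm_eq_inner_signVec {B : ℝ} {σ : Fin d → Bool} {w : Vec d} (hw : w ∈ orthantPart B σ) :
    l1Norm w = inner ℝ (signVec σ) w := by
  rw [PiLp.inner_apply]
  refine Finset.sum_congr rfl fun i _ => ?_
  have h := hw.1 i
  simp only [signVec] at h ⊢
  cases hσ : σ i <;> simp only [hσ, Bool.false_eq_true, if_true, if_false] at h ⊢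
  · simp [abs_of_nonpos (show w i ≤ 0 by linarith)]
  · simp [abs_of_nonneg (show 0 ≤ w i by linarith)]

lemma orthantPart_subset (B : ℝ) (σ : Fin d → Bool) : orthantPart B σ ⊆ l1Ball d B :=
  fun w hw => by
    show l1Norm w ≤ B
    rw [l1Norm_eq_inner_signVec hw]; exact hw.2

lemma exists_mem_orthantPart {B : ℝ} {w : Vec d} (hw : w ∈ l1Ball d B) :
    ∃ σ, w ∈ orthantPart B σ := by
  classical
  have h1 : ∀ i, 0 ≤ signVec (fun i => decide (0 ≤ w i)) i * w i := fun i => by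
    by_cases h : 0 ≤ w i
    · simp [signVec, h]
    · simp only [signVec, h, decide_false, Bool.false_eq_true, if_false]; linarith
  refine ⟨fun i => decide (0 ≤ w i), h1, ?_⟩
  rw [← l1Norm_eq_inner_signVec (B := inner ℝ (signVec fun i => decide (0 ≤ w i)) w) ⟨h1, le_rfl⟩]
  exact hw

/-- Adding a multiple of the `ℓ₁` norm to a piecewise convex quadratic function, one obtains a
function with the error bound condition. -/
theorem exists_EBC_add_l1Norm {B lam : ℝ} (hB : 0 ≤ B) {F : Vec d → ℝ}
    (hF : IsPiecewiseConvexQuadraticOn (l1Ball d B) F) :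
    ∃ α : ℝ, 0 < α ∧ EBC (l1Ball d B) (fun w => F w + lam * l1Norm w) 1 α := by
  obtain ⟨m, Q, e, g, c, hQ, hcover, hFQ⟩ := hF
  refine exists_EBC_of_pieces (ι := Fin m × (Fin d → Bool)) (isCompact_l1Ball B)
    ⟨0, zero_mem_l1Ball hB⟩ (S := fun i => Q i.1 ∩ orthantPart B i.2)
    (fun i => (hQ i.1).inter (isPolyhedron_orthantPart B i.2)) ?_
    (e := fun i => e i.1) (g := fun i => g i.1 + lam • signVec i.2) (c := fun i => c i.1) ?_
  · ext w
    simp only [Set.mem_iUnion, Set.mem_inter_iff, Prod.exists]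
    constructor
    · intro hw
      obtain ⟨j, hj⟩ := Set.mem_iUnion.1 (hcover hw)
      obtain ⟨σ, hσ⟩ := exists_mem_orthantPart hw
      exact ⟨j, σ, hj, hσ⟩
    · rintro ⟨j, σ, -, hσ⟩
      exact orthantPart_subset B σ hσ
  · rintro ⟨j, σ⟩ w ⟨hj, hσ⟩
    simp only
    rw [hFQ j w ⟨orthantPart_subset B σ hσ, hj⟩, l1Norm_eq_inner_signVec hσ]
    simp only [convexQuadratic, inner_add_left, real_inner_smul_left]
    ring

lemma isPolyhedron_univ : IsPolyhedron (Set.univ : Set (Vec d)) :=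
  ⟨0, fun _ => 0, fun _ => 0, by ext; simp⟩

lemma IsPiecewiseLinearOn.isPiecewiseConvexQuadraticOn {K : Set (Vec d)} {F : Vec d → ℝ}
    (hF : IsPiecewiseLinearOn K F) : IsPiecewiseConvexQuadraticOn K F := by
  obtain ⟨m, Q, a, c, hQ, hcover, h⟩ := hF
  exact ⟨m, Q, fun _ _ => 0, a, c, hQ, hcover, fun i w hw => by simp [convexQuadratic, h i w hw]⟩

/-- If a quadratic polynomial plus a multiple of the `ℓ₁` norm is convex on the `ℓ₁` ball, then its
quadratic part is nonnegative. -/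
lemma quadraticForm_nonneg_of_convexOn {B lam : ℝ} (hB : 0 < B) {F : Vec d → ℝ}
    {A : Matrix (Fin d) (Fin d) ℝ} {b : Fin d → ℝ} {c : ℝ}
    (hF : ∀ w ∈ l1Ball d B, F w = w.ofLp ⬝ᵥ A.mulVec w.ofLp + w.ofLp ⬝ᵥ b + c)
    (hconv : ConvexOn ℝ (l1Ball d B) fun w => F w + lam * l1Norm w) (v : Fin d → ℝ) :
    0 ≤ v ⬝ᵥ A.mulVec v := by
  -- The segment `x ± η v` around the constant vector `β` has coordinates in `[0, 2β]`. It stays in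
  -- the ball and in the positive orthant, where the ℓ₁ norm is the sum of coordinates.
  set β : ℝ := B / (2 * (d + 1)) with hβ
  have hβ0 : 0 < β := by positivity
  set η : ℝ := β / (‖v‖ + 1) with hη
  have hη0 : 0 < η := by positivity
  have hηv : ∀ i, |η * v i| ≤ β := fun i => by
    rw [abs_mul, abs_of_pos hη0, hη, div_mul_eq_mul_div, div_le_iff₀ (by positivity)]
    have : |v i| ≤ ‖v‖ := norm_le_pi_norm v i
    gcongr; linarith
  have hnonneg : ∀ i, 0 ≤ β + η * v i ∧ 0 ≤ β - η * v i := fun i => by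
    have := abs_le.1 (hηv i); constructor <;> linarith
  set x : Fin d → ℝ := fun _ => β
  set p : Fin d → ℝ := η • v
  have hdB : (d : ℝ) * (2 * β) ≤ B := by
    rw [hβ]; field_simp; nlinarith
  have l1 : ∀ y : Fin d → ℝ, (∀ i, 0 ≤ y i) → l1Norm (WithLp.toLp 2 y : Vec d) = ∑ i, y i :=
    fun y hy => Finset.sum_congr rfl fun i _ => abs_of_nonneg (hy i)
  have hmem : ∀ y : Fin d → ℝ, (∀ i, 0 ≤ y i) → (∀ i, y i ≤ 2 * β) →
      (WithLp.toLp 2 y : Vec d) ∈ l1Ball d B := fun y hy hy2 => by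
    show l1Norm _ ≤ B
    rw [l1 y hy]
    calc ∑ i, y i ≤ ∑ _i : Fin d, 2 * β := Finset.sum_le_sum fun i _ => hy2 i
      _ = d * (2 * β) := by simp
      _ ≤ B := hdB
  have hp0 : ∀ i, 0 ≤ (x + p) i := fun i => (hnonneg i).1
  have hm0 : ∀ i, 0 ≤ (x - p) i := fun i => (hnonneg i).2
  have hp2 : ∀ i, (x + p) i ≤ 2 * β := fun i => by
    have := (hnonneg i).2; simp only [x, p, Pi.add_apply, Pi.smul_apply, smul_eq_mul]; linarith
  have hm2 : ∀ i, (x - p) i ≤ 2 * β := fun i => by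
    have := (hnonneg i).1; simp only [x, p, Pi.sub_apply, Pi.smul_apply, smul_eq_mul]; linarith
  have hx0 : ∀ i, 0 ≤ x i := fun _ => hβ0.le
  have hx2 : ∀ i, x i ≤ 2 * β := fun _ => by simp only [x]; linarith
  -- Midpoint convexity on this segment: all affine contributions cancel, and what remains is the
  -- quadratic form at `p = η v`.
  have h := hconv.2 (hmem _ hp0 hp2) (hmem _ hm0 hm2) (show (0 : ℝ) ≤ 1 / 2 by norm_num)
    (show (0 : ℝ) ≤ 1 / 2 by norm_num) (by norm_num)
  have hmid : (1 / 2 : ℝ) • (WithLp.toLp 2 (x + p) : Vec d) + (1 / 2 : ℝ) • WithLp.toLp 2 (x - p)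
      = WithLp.toLp 2 x := by
    ext i
    simp only [PiLp.add_apply, PiLp.smul_apply, smul_eq_mul, Pi.add_apply, Pi.sub_apply]
    ring
  rw [hmid] at h
  simp only [hF _ (hmem _ hp0 hp2), hF _ (hmem _ hm0 hm2), hF _ (hmem _ hx0 hx2), l1 _ hp0,
    l1 _ hm0, l1 _ hx0, smul_eq_mul, Matrix.mulVec_add, Matrix.mulVec_sub, add_dotProduct,
    sub_dotProduct, dotProduct_add, dotProduct_sub, Pi.add_apply, Pi.sub_apply,
    Finset.sum_add_distrib, Finset.sum_sub_distrib] at h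
  have hpp : p ⬝ᵥ A.mulVec p = η ^ 2 * (v ⬝ᵥ A.mulVec v) := by
    simp only [p, Matrix.mulVec_smul, smul_dotProduct, dotProduct_smul, smul_eq_mul]; ring
  have h2 : 0 ≤ η ^ 2 * (v ⬝ᵥ A.mulVec v) := by rw [← hpp]; linarith
  exact nonneg_of_mul_nonneg_right h2 (by positivity)

open scoped MatrixOrder Matrix.Norms.L2Operator in
-- Since `A` need not be symmetric, it is replaced by its symmetric part, which has the same
-- quadratic form and is positive semidefinite. Factoring this part as `Cᵀ C`, the rows of `C` serve
-- as the vectors.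
lemma exists_sum_sq_of_quadraticForm_nonneg (A : Matrix (Fin d) (Fin d) ℝ)
    (hA : ∀ v : Fin d → ℝ, 0 ≤ v ⬝ᵥ A.mulVec v) :
    ∃ e : Fin d → Vec d, ∀ w : Vec d, w.ofLp ⬝ᵥ A.mulVec w.ofLp = ∑ k, inner ℝ (e k) w ^ 2 := by
  set S : Matrix (Fin d) (Fin d) ℝ := (1 / 2 : ℝ) • (A + A.transpose) with hS
  have hSA : ∀ v : Fin d → ℝ, v ⬝ᵥ S.mulVec v = v ⬝ᵥ A.mulVec v := fun v => by
    have : v ⬝ᵥ A.transpose.mulVec v = v ⬝ᵥ A.mulVec v := by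
      rw [Matrix.mulVec_transpose, dotProduct_comm, Matrix.dotProduct_mulVec]
    rw [hS, Matrix.smul_mulVec, Matrix.add_mulVec, dotProduct_smul, dotProduct_add, this,
      smul_eq_mul]
    ring
  have hpsd : S.PosSemidef := by
    refine .of_dotProduct_mulVec_nonneg ?_ fun v => ?_
    · rw [hS, Matrix.IsHermitian, Matrix.conjTranspose_eq_transpose_of_trivial]
      simp [add_comm]
    · rw [star_trivial, hSA]; exact hA v
  obtain ⟨C, hC⟩ := CStarAlgebra.nonneg_iff_eq_star_mul_self.mp hpsd.nonneg
  refine ⟨fun k => WithLp.toLp 2 (C k), fun w => ?_⟩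
  rw [← hSA, hC, Matrix.star_eq_conjTranspose, ← Matrix.mulVec_mulVec, Matrix.dotProduct_mulVec,
    Matrix.conjTranspose_eq_transpose_of_trivial, Matrix.vecMul_transpose]
  refine Finset.sum_congr rfl fun k _ => ?_
  rw [PiLp.inner_apply, ← sq]
  congr 1
  simp [Matrix.mulVec, dotProduct, mul_comm]

lemma IsQuadraticOn.isPiecewiseConvexQuadraticOn {B lam : ℝ} (hB : 0 < B) {F : Vec d → ℝ}
    (hF : IsQuadraticOn (l1Ball d B) F)
    (hconv : ConvexOn ℝ (l1Ball d B) fun w => F w + lam * l1Norm w) :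
    IsPiecewiseConvexQuadraticOn (l1Ball d B) F := by
  obtain ⟨A, b, c, h⟩ := hF
  obtain ⟨e, he⟩ := exists_sum_sq_of_quadraticForm_nonneg A
    (quadraticForm_nonneg_of_convexOn hB h hconv)
  refine ⟨1, fun _ => Set.univ, fun _ => e, fun _ => WithLp.toLp 2 b, fun _ => c,
    fun _ => isPolyhedron_univ, fun w _ => by simp, fun _ w hw => ?_⟩
  rw [h w hw.1, he, convexQuadratic]
  rfl

/-- The error bound condition with exponent one for `ℓ₁`-regularized convex risks with quadratic or
piecewise linear expected loss. -/
theorem exists_EBC_risk {Z : Type*} [MeasurableSpace Z] {μ : Measure Z} {f : Vec d → Z → ℝ}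
    {B lam : ℝ} (hB : 0 < B) (hconv : ConvexOn ℝ (l1Ball d B) (risk μ f lam))
    (hF : IsQuadraticOn (l1Ball d B) (expectedLoss μ f) ∨
      IsPiecewiseLinearOn (l1Ball d B) (expectedLoss μ f)) :
    ∃ α : ℝ, 0 < α ∧ EBC (l1Ball d B) (risk μ f lam) 1 α :=
  exists_EBC_add_l1Norm hB.le <| hF.elim
    (fun h => h.isPiecewiseConvexQuadraticOn hB hconv)
    fun h => h.isPiecewiseConvexQuadraticOn

/-! ### Bernstein's inequality -/

section Bernstein

variable {Z : Type*} [MeasurableSpace Z] {Ω : Type*} [MeasurableSpace Ω]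

/-- Uses `exp y ≤ 1 + y + y²` for `|y| ≤ 1`: the condition on `s` keeps the exponent in this range,
and the first-order term integrates to zero. A bound on the uncentered second moment suffices,
because the variance is no larger. -/
lemma mgf_le_of_abs_le {μ : Measure Z} [IsProbabilityMeasure μ] {X : Z → ℝ}
    (hX : AEMeasurable X μ) {b V s : ℝ} (hb : ∀ z, |X z| ≤ b) (hV : ∫ z, X z ^ 2 ∂μ ≤ V)
    (hs : 0 ≤ s) (hbs : 2 * b * s ≤ 1) :
    mgf (fun z => ∫ z, X z ∂μ - X z) μ s ≤ Real.exp (s ^ 2 * V) := by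
  set m := ∫ z, X z ∂μ
  have hXi : Integrable X μ := Integrable.of_bound hX.aestronglyMeasurable b
    (Filter.Eventually.of_forall hb)
  have hX2 : Integrable (fun z => X z ^ 2) μ := Integrable.of_bound
    (hX.pow_const 2).aestronglyMeasurable (b ^ 2) (Filter.Eventually.of_forall fun z => by
      rw [Real.norm_eq_abs, abs_pow]
      exact pow_le_pow_left₀ (abs_nonneg _) (hb z) 2)
  have hm : |m| ≤ b := by
    have := norm_integral_le_of_norm_le_const (μ := μ) (f := X) (Filter.Eventually.of_forall hb)
    simpa using this
  have hpt : ∀ z, Real.exp (s * (m - X z))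
      ≤ 1 + s * (m - X z) + s ^ 2 * (m ^ 2 - 2 * m * X z + X z ^ 2) := fun z => by
    have h1 : |s * (m - X z)| ≤ 1 := by
      rw [abs_mul, abs_of_nonneg hs]
      have := abs_sub m (X z)
      nlinarith [hb z]
    have := (abs_le.1 (Real.abs_exp_sub_one_sub_id_le h1)).2
    nlinarith
  have hi1 : Integrable (fun z => s * (m - X z)) μ := ((integrable_const m).sub hXi).const_mul s
  have hi2 : Integrable (fun z => m ^ 2 - 2 * m * X z + X z ^ 2) μ :=
    ((integrable_const _).sub (hXi.const_mul _)).add hX2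
  have hi3 : Integrable (fun z => 1 + s * (m - X z)) μ := (integrable_const _).add hi1
  have hi4 : Integrable (fun z => m ^ 2 - 2 * m * X z) μ :=
    (integrable_const _).sub (hXi.const_mul _)
  have hexp : Integrable (fun z => Real.exp (s * (m - X z))) μ := by
    refine Integrable.of_bound
      ((((hX.const_sub m).const_mul s)).exp.aestronglyMeasurable) (Real.exp 1)
      (Filter.Eventually.of_forall fun z => ?_)
    rw [Real.norm_eq_abs, Real.abs_exp]
    refine Real.exp_le_exp.2 ?_
    have h1 := abs_le.1 (hb z)
    have h2 := abs_le.1 hm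
    nlinarith
  calc mgf (fun z => m - X z) μ s
      ≤ ∫ z, (1 + s * (m - X z) + s ^ 2 * (m ^ 2 - 2 * m * X z + X z ^ 2)) ∂μ :=
        integral_mono hexp (hi3.add (hi2.const_mul _)) hpt
    _ = 1 + s ^ 2 * (∫ z, X z ^ 2 ∂μ - m ^ 2) := by
      rw [integral_add hi3 (hi2.const_mul _),
        integral_add (integrable_const _) hi1, integral_const_mul, integral_const_mul,
        integral_sub (integrable_const _) hXi,
        integral_add hi4 hX2,
        integral_sub (integrable_const _) (hXi.const_mul _), integral_const_mul]
      simp only [integral_const, probReal_univ, one_smul]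
      ring
    _ ≤ s ^ 2 * V + 1 := by nlinarith [sq_nonneg m, sq_nonneg s]
    _ ≤ Real.exp (s ^ 2 * V) := Real.add_one_le_exp _

/-- A one-sided Bernstein inequality for the mean of an i.i.d. sample, with a free parameter `s`. -/
theorem IsIIDSample.measure_integral_sub_mean_ge_le {ν : Measure Ω} [IsProbabilityMeasure ν]
    {μ : Measure Z} [IsProbabilityMeasure μ] {ζ : ℕ → Ω → Z} (hζ : IsIIDSample ν μ ζ)
    {X : Z → ℝ} (hX : AEMeasurable X μ) {b V s : ℝ} (hb : ∀ z, |X z| ≤ b)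
    (hV : ∫ z, X z ^ 2 ∂μ ≤ V) (hs : 0 < s) (hbs : 2 * b * s ≤ 1) {n : ℕ} (hn : 0 < n) (q : ℝ) :
    ν {ω | s * V + q / s ≤ ∫ z, X z ∂μ - (1 / (n : ℝ)) * ∑ i ∈ Finset.range n, X (ζ i ω)}
      ≤ ENNReal.ofReal (Real.exp (-(n * q))) := by
  set m := ∫ z, X z ∂μ
  set Y : ℕ → Ω → ℝ := fun i ω => m - X (ζ i ω) with hY
  have hXζ : ∀ i, AEMeasurable (fun z => m - X z) (ν.map (ζ i)) := fun i => by
    rw [hζ.law i]; exact hX.const_sub m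
  have hYm : ∀ i, AEMeasurable (Y i) ν := fun i =>
    (hXζ i).comp_measurable (hζ.measurable i)
  have hind : iIndepFun Y ν := hζ.indep.comp₀ (fun _ z => m - X z)
    (fun i => (hζ.measurable i).aemeasurable) hXζ
  have hmgf : ∀ i, mgf (Y i) ν s ≤ Real.exp (s ^ 2 * V) := fun i => by
    have : mgf (Y i) ν s = mgf (fun z => m - X z) μ s := by
      simp only [mgf, hY]
      rw [← hζ.law i, integral_map (hζ.measurable i).aemeasurable
        (((hXζ i).const_mul s).exp.aestronglyMeasurable)]
    rw [this]
    exact mgf_le_of_abs_le hX hb hV hs.le hbs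
  have hsum : mgf (∑ i ∈ Finset.range n, Y i) ν s ≤ Real.exp (n * (s ^ 2 * V)) := by
    rw [hind.mgf_sum₀ hYm]
    calc ∏ i ∈ Finset.range n, mgf (Y i) ν s
        ≤ ∏ _i ∈ Finset.range n, Real.exp (s ^ 2 * V) :=
          Finset.prod_le_prod (fun i _ => mgf_nonneg) fun i _ => hmgf i
      _ = Real.exp (n * (s ^ 2 * V)) := by
          rw [Finset.prod_const, Finset.card_range, ← Real.exp_nat_mul]
  have hm : |m| ≤ b := by
    have := norm_integral_le_of_norm_le_const (μ := μ) (f := X) (Filter.Eventually.of_forall hb)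
    simpa using this
  have hint : Integrable (fun ω => Real.exp (s * (∑ i ∈ Finset.range n, Y i) ω)) ν := by
    refine Integrable.of_bound
      (((Finset.aemeasurable_sum _ fun i _ => hYm i).const_mul s).exp.aestronglyMeasurable)
      (Real.exp (s * (n * (2 * b)))) (Filter.Eventually.of_forall fun ω => ?_)
    rw [Real.norm_eq_abs, Real.abs_exp]
    refine Real.exp_le_exp.2 (mul_le_mul_of_nonneg_left ?_ hs.le)
    rw [Finset.sum_apply]
    calc ∑ i ∈ Finset.range n, Y i ω ≤ ∑ _i ∈ Finset.range n, 2 * b :=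
          Finset.sum_le_sum fun i _ => by
            have h1 := abs_le.1 (hb (ζ i ω))
            have h2 := abs_le.1 hm
            simp only [hY]; linarith
      _ = n * (2 * b) := by simp
  -- In Chernoff's bound the term `s * V` of the threshold pays exactly for the moment generating
  -- function, leaving `exp (-n q)`.
  have hch := measure_ge_le_exp_mul_mgf (n * (s * V + q / s)) hs.le hint
  have hn' : (0 : ℝ) < n := by exact_mod_cast hn
  have hset : {ω | s * V + q / s ≤ m - (1 / (n : ℝ)) * ∑ i ∈ Finset.range n, X (ζ i ω)}
      = {ω | n * (s * V + q / s) ≤ (∑ i ∈ Finset.range n, Y i) ω} := by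
    ext ω
    simp only [Set.mem_ofPred_eq, Finset.sum_apply, hY, Finset.sum_sub_distrib, Finset.sum_const,
      Finset.card_range, nsmul_eq_mul]
    rw [← mul_le_mul_iff_right₀ hn']
    have : (n : ℝ) * (m - 1 / n * ∑ i ∈ Finset.range n, X (ζ i ω))
        = n * m - ∑ i ∈ Finset.range n, X (ζ i ω) := by field_simp
    rw [this]
  rw [hset, ← ofReal_measureReal]
  refine ENNReal.ofReal_le_ofReal (hch.trans ?_)
  calc _ ≤ Real.exp (-s * (n * (s * V + q / s))) * Real.exp (n * (s ^ 2 * V)) := by gcongr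
    _ = Real.exp (-(n * q)) := by
      rw [← Real.exp_add]
      congr 1
      field_simp
      ring

end Bernstein

/-! ### Nets of bounded sets -/

/-- Volume comparison: the balls of radius `ε / 2` about the points are disjoint and lie in the ball
of radius `R + ε / 2`. -/
lemma card_le_of_separated {R ε : ℝ} (hR : 0 ≤ R) (hε : 0 < ε) (s : Finset (Vec d))
    (hs : ∀ c ∈ s, ‖c‖ ≤ R) (h : ∀ x ∈ s, ∀ y ∈ s, x ≠ y → ε ≤ ‖x - y‖) :
    (s.card : ℝ) ≤ (1 + 2 * R / ε) ^ d := by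
  set δ : ℝ := ε / 2 with hδ
  set ρ : ℝ := R + ε / 2 with hρ
  have hδ0 : 0 < δ := by positivity
  have hρ0 : 0 < ρ := by positivity
  have D : Set.Pairwise (s : Set (Vec d)) (Function.onFun Disjoint fun c => Metric.ball c δ) := by
    intro x hx y hy hxy
    refine Metric.ball_disjoint_ball ?_
    rw [dist_eq_norm, hδ, add_halves]
    exact h x hx y hy hxy
  have hsub : (⋃ c ∈ s, Metric.ball c δ) ⊆ Metric.ball (0 : Vec d) ρ :=
    Set.iUnion₂_subset fun x hx => Metric.ball_subset_ball' (by
      rw [dist_zero_right]; linarith [hs x hx])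
  have I : (s.card : ENNReal) * ENNReal.ofReal (δ ^ d) * volume (Metric.ball (0 : Vec d) 1) ≤
      ENNReal.ofReal (ρ ^ d) * volume (Metric.ball (0 : Vec d) 1) := by
    have h1 := measure_mono (μ := volume) hsub
    rw [measure_biUnion_finset D fun c _ => measurableSet_ball] at h1
    simp only [Measure.addHaar_ball_of_pos _ _ hδ0, Measure.addHaar_ball_of_pos _ _ hρ0,
      Finset.sum_const, nsmul_eq_mul, finrank_euclideanSpace_fin] at h1
    rwa [← mul_assoc] at h1
  have J := (ENNReal.mul_le_mul_iff_left (Metric.measure_ball_pos _ _ zero_lt_one).ne'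
    measure_ball_lt_top.ne).1 I
  have hK : (s.card : ℝ) * δ ^ d ≤ ρ ^ d := by
    have := ENNReal.toReal_le_of_le_ofReal (pow_nonneg hρ0.le _) J
    simpa [ENNReal.toReal_ofReal (pow_nonneg hδ0.le d)] using this
  calc (s.card : ℝ) ≤ ρ ^ d / δ ^ d := by rwa [le_div_iff₀ (by positivity)]
    _ = (1 + 2 * R / ε) ^ d := by
      rw [← div_pow]; congr 1; rw [hρ, hδ]; field_simp; ring

/-- Sets in a Euclidean ball of radius `R` have internal `ε`-nets of at most `(1 + 2R/ε)^d`
points. -/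
lemma exists_net {K : Set (Vec d)} {R ε : ℝ} (hR : 0 ≤ R) (hε : 0 < ε) (hK : ∀ w ∈ K, ‖w‖ ≤ R) :
    ∃ N : Finset (Vec d), (∀ w ∈ N, w ∈ K) ∧ (∀ w ∈ K, ∃ w' ∈ N, ‖w - w'‖ ≤ ε) ∧
      (N.card : ℝ) ≤ (1 + 2 * R / ε) ^ d := by
  classical
  let good : Finset (Vec d) → Prop := fun s =>
    (∀ w ∈ s, w ∈ K) ∧ ∀ x ∈ s, ∀ y ∈ s, x ≠ y → ε ≤ ‖x - y‖
  have hcard : ∀ s, good s → (s.card : ℝ) ≤ (1 + 2 * R / ε) ^ d := fun s hs =>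
    card_le_of_separated hR hε s (fun c hc => hK c (hs.1 c hc)) hs.2
  have hbdd : BddAbove {k | ∃ s, good s ∧ s.card = k} := by
    refine ⟨⌊(1 + 2 * R / ε) ^ d⌋₊, ?_⟩
    rintro _ ⟨s, hs, rfl⟩
    exact Nat.le_floor (hcard s hs)
  -- A separated subset of maximal cardinality is a net: a point far from all of it could be added.
  obtain ⟨N, hN, hNc⟩ := Nat.sSup_mem
    (s := {k | ∃ s, good s ∧ s.card = k}) ⟨0, ∅, ⟨by simp, by simp⟩, rfl⟩ hbdd
  refine ⟨N, hN.1, fun w hw => ?_, hcard N hN⟩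
  by_contra! hfar
  have hwN : w ∉ N := fun h => by
    have := hfar w h
    simp at this
    linarith
  have hgood : good (insert w N) := by
    refine ⟨fun x hx => ?_, fun x hx y hy hxy => ?_⟩
    · rcases Finset.mem_insert.1 hx with rfl | hx
      exacts [hw, hN.1 x hx]
    · rcases Finset.mem_insert.1 hx with hx' | hx' <;>
        rcases Finset.mem_insert.1 hy with hy' | hy'
      · exact absurd (hx'.trans hy'.symm) hxy
      · rw [hx']; exact (hfar y hy').le
      · rw [hy', norm_sub_rev]; exact (hfar x hx').le
      · exact hN.2 x hx' y hy' hxy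
  have := le_csSup hbdd ⟨_, hgood, rfl⟩
  rw [← hNc, Finset.card_insert_of_notMem hwN] at this
  omega

/-! ### Uniform deviation bounds over pairs of points -/

section Deviation

lemma IsLipschitzLoss.abs_mean_sub_le {Z : Type*} {f : Vec d → Z → ℝ}
    {K : Set (Vec d)} {G : ℝ} (hG : 0 ≤ G)
    (hL : IsLipschitzLoss K f G) (n : ℕ) (z : ℕ → Z) {w u : Vec d} (hw : w ∈ K)
    (hu : u ∈ K) :
    |(1 / (n : ℝ)) * ∑ i ∈ Finset.range n, (f w (z i) - f u (z i))| ≤ G * ‖w - u‖ := by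
  rcases Nat.eq_zero_or_pos n with rfl | hn
  · simpa using mul_nonneg hG (norm_nonneg _)
  have hn' : (0 : ℝ) < n := by exact_mod_cast hn
  rw [abs_mul, abs_of_pos (by positivity), one_div, inv_mul_le_iff₀ hn']
  refine (Finset.abs_sum_le_sum_abs _ _).trans ?_
  refine (Finset.sum_le_sum fun i _ => hL (z i) w hw u hu).trans ?_
  simp

variable {Z : Type*} [MeasurableSpace Z]

/-- The deviation of the empirical mean of `f w - f v` from its expectation. -/
def deviation (μ : Measure Z) (f : Vec d → Z → ℝ) (n : ℕ) (z : ℕ → Z) (w v : Vec d) : ℝ :=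
  expectedLoss μ f w - expectedLoss μ f v
    - (1 / (n : ℝ)) * ∑ i ∈ Finset.range n, (f w (z i) - f v (z i))

variable {μ : Measure Z} {f : Vec d → Z → ℝ} {K : Set (Vec d)}

/-- Optimality of `w` for the empirical risk is subtracted from the difference of true risks; the
regularization terms cancel. -/
lemma risk_sub_le_deviation {lam : ℝ} {n : ℕ} {z : ℕ → Z} {w v : Vec d}
    (hw : w ∈ minimizers K (empiricalRisk f lam n z)) (hv : v ∈ K) :
    risk μ f lam w - risk μ f lam v ≤ deviation μ f n z w v := by
  have h := hw.2 v hv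
  simp only [empiricalRisk] at h
  simp only [risk, deviation, Finset.sum_sub_distrib, mul_sub]
  linarith

lemma IsLipschitzLoss.abs_expectedLoss_sub_le [IsProbabilityMeasure μ] {G : ℝ}
    (hL : IsLipschitzLoss K f G) (hint : ∀ w ∈ K, Integrable (f w) μ) {w u : Vec d} (hw : w ∈ K)
    (hu : u ∈ K) : |expectedLoss μ f w - expectedLoss μ f u| ≤ G * ‖w - u‖ := by
  have h := norm_integral_le_of_norm_le_const (μ := μ) (f := fun z => f w z - f u z)
    (Filter.Eventually.of_forall fun z => hL z w hw u hu)
  rw [integral_sub (hint w hw) (hint u hu)] at h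
  simpa [expectedLoss] using h

lemma IsLipschitzLoss.deviation_le [IsProbabilityMeasure μ] {G : ℝ} (hG : 0 ≤ G)
    (hL : IsLipschitzLoss K f G) (hint : ∀ w ∈ K, Integrable (f w) μ) (n : ℕ) (z : ℕ → Z)
    {w v : Vec d} (hw : w ∈ K) (hv : v ∈ K) :
    deviation μ f n z w v ≤ 2 * G * ‖w - v‖ := by
  have h1 := abs_le.1 (hL.abs_expectedLoss_sub_le hint hw hv)
  have h2 := abs_le.1 (hL.abs_mean_sub_le hG n z hw hv)
  simp only [deviation]
  linarith

/-- The deviation is additive along chains of points, so passing through `w'` and `v'` costs two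
short deviations of at most `2 G ε` each. -/
lemma IsLipschitzLoss.deviation_le_deviation_add [IsProbabilityMeasure μ] {G : ℝ} (hG : 0 ≤ G)
    (hL : IsLipschitzLoss K f G) (hint : ∀ w ∈ K, Integrable (f w) μ) (n : ℕ) (z : ℕ → Z)
    {w v w' v' : Vec d} (hw : w ∈ K) (hv : v ∈ K) (hw' : w' ∈ K) (hv' : v' ∈ K) {ε : ℝ}
    (h : ‖w - w'‖ ≤ ε) (h' : ‖v - v'‖ ≤ ε) :
    deviation μ f n z w v ≤ deviation μ f n z w' v' + 4 * G * ε := by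
  have h1 := hL.deviation_le hG hint n z hw hw'
  have h2 := hL.deviation_le hG hint n z hv' hv
  have h3 : deviation μ f n z w v
      = deviation μ f n z w' v' + deviation μ f n z w w' + deviation μ f n z v' v := by
    simp only [deviation, Finset.sum_sub_distrib]; ring
  rw [norm_sub_rev] at h2
  nlinarith

/-- The level of the union bound over pairs of points of a net. -/
def netLevel (d n : ℕ) (δ : ℝ) : ℝ := (8 * (d * Real.log n) + Real.log (1 / δ)) / n

/-- There is a `B / n²`-net of the `ℓ₁` ball such that, with probability at least `1 - δ`,
Bernstein's inequality holds for the differences of the losses at any two points of the net. -/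
theorem exists_net_deviation_bound [IsProbabilityMeasure μ] {B G : ℝ} (hB : 0 < B)
    (hint : ∀ w ∈ l1Ball d B, Integrable (f w) μ) (hL : IsLipschitzLoss (l1Ball d B) f G)
    {Ω : Type*} [MeasurableSpace Ω] {ν : Measure Ω} [IsProbabilityMeasure ν] {ζ : ℕ → Ω → Z}
    (hζ : IsIIDSample ν μ ζ) {n : ℕ} (hn : 2 ≤ n) {δ : ℝ} (hδ : 0 < δ)
    {s V : Vec d → Vec d → ℝ}
    (hs : ∀ w ∈ l1Ball d B, ∀ v ∈ l1Ball d B, 0 < s w v ∧ 2 * (G * ‖w - v‖) * s w v ≤ 1)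
    (hV : ∀ w ∈ l1Ball d B, ∀ v ∈ l1Ball d B, ∫ z, (f w z - f v z) ^ 2 ∂μ ≤ V w v) :
    ∃ N : Finset (Vec d), (∀ w ∈ N, w ∈ l1Ball d B) ∧
      (∀ w ∈ l1Ball d B, ∃ w' ∈ N, ‖w - w'‖ ≤ B / n ^ 2) ∧
      ν {ω | ∃ w ∈ N, ∃ v ∈ N, s w v * V w v + netLevel d n δ / s w v
          ≤ deviation μ f n (fun i => ζ i ω) w v} ≤ ENNReal.ofReal δ := by
  have hn2 : (2 : ℝ) ≤ n := by exact_mod_cast hn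
  have hn0 : (0 : ℝ) < n := by linarith
  obtain ⟨N, hNK, hN, hcard⟩ := exists_net hB.le (show 0 < B / (n : ℝ) ^ 2 by positivity)
    fun w (hw : w ∈ l1Ball d B) => norm_le_of_mem_l1Ball hw
  refine ⟨N, hNK, hN, ?_⟩
  set q := netLevel d n δ with hq
  -- As `1 + 2n² ≤ n⁴` for `n ≥ 2`, the net has at most `n ^ (4d)` points. The number of pairs is at
  -- most `n ^ (8d)`, whence the factor 8 in `netLevel`.
  have hcard' : (N.card : ℝ) ≤ Real.exp (4 * (d * Real.log n)) := by
    have hbase : 1 + 2 * B / (B / (n : ℝ) ^ 2) ≤ (n : ℝ) ^ 4 := by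
      have : 2 * B / (B / (n : ℝ) ^ 2) = 2 * n ^ 2 := by field_simp
      rw [this]; nlinarith [sq_nonneg ((n : ℝ) ^ 2 - 4), mul_self_nonneg ((n : ℝ) - 2)]
    calc (N.card : ℝ) ≤ (1 + 2 * B / (B / (n : ℝ) ^ 2)) ^ d := hcard
      _ ≤ ((n : ℝ) ^ 4) ^ d := by gcongr
      _ = Real.exp (4 * (d * Real.log n)) := by
        rw [← pow_mul, ← Real.exp_log (pow_pos hn0 _), Real.log_pow]
        push_cast; ring_nf
  have hpair : ∀ w ∈ N, ∀ v ∈ N, ν {ω | s w v * V w v + q / s w v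
      ≤ deviation μ f n (fun i => ζ i ω) w v} ≤ ENNReal.ofReal (Real.exp (-(n * q))) := by
    intro w hw v hv
    have hwK := hNK w hw
    have hvK := hNK v hv
    have hi := (hint w hwK).sub (hint v hvK)
    have h := hζ.measure_integral_sub_mean_ge_le (X := fun z => f w z - f v z)
      hi.aestronglyMeasurable.aemeasurable (fun z => hL z w hwK v hvK) (hV w hwK v hvK)
      (hs w hwK v hvK).1 (hs w hwK v hvK).2 (show 0 < n by omega) q
    rw [integral_sub (hint w hwK) (hint v hvK)] at h
    exact h
  have hset : {ω | ∃ w ∈ N, ∃ v ∈ N, s w v * V w v + q / s w v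
      ≤ deviation μ f n (fun i => ζ i ω) w v} = ⋃ w ∈ N, ⋃ v ∈ N,
      {ω | s w v * V w v + q / s w v ≤ deviation μ f n (fun i => ζ i ω) w v} := by
    ext ω; simp
  rw [hset]
  calc _ ≤ ∑ w ∈ N, ∑ v ∈ N,
        ν {ω | s w v * V w v + q / s w v ≤ deviation μ f n (fun i => ζ i ω) w v} :=
        (measure_biUnion_finset_le _ _).trans
          (Finset.sum_le_sum fun w _ => measure_biUnion_finset_le _ _)
    _ ≤ ∑ w ∈ N, ∑ v ∈ N, ENNReal.ofReal (Real.exp (-(n * q))) :=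
        Finset.sum_le_sum fun w hw => Finset.sum_le_sum fun v hv => hpair w hw v hv
    _ = ENNReal.ofReal ((N.card : ℝ) * (N.card * Real.exp (-(n * q)))) := by
        simp only [Finset.sum_const, nsmul_eq_mul]
        rw [ENNReal.ofReal_mul (by positivity), ENNReal.ofReal_mul (by positivity)]
        simp
    _ ≤ ENNReal.ofReal δ := by
        refine ENNReal.ofReal_le_ofReal ?_
        have hnq : n * q = 4 * (d * Real.log n) + (4 * (d * Real.log n) + Real.log (1 / δ)) := by
          rw [hq, netLevel]; field_simp; ring
        calc (N.card : ℝ) * (N.card * Real.exp (-(n * q)))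
            ≤ Real.exp (4 * (d * Real.log n)) * (Real.exp (4 * (d * Real.log n))
              * Real.exp (-(n * q))) := by gcongr
          _ = δ := by
            rw [← Real.exp_add, ← Real.exp_add, hnq, one_div, Real.log_inv]
            ring_nf
            exact Real.exp_log hδ

/-- With probability at least `1 - δ`, the excess risk of an empirical risk minimizer `w` with
respect to any `v` is controlled by Bernstein's inequality for two points `w'`, `v'` close to
them. -/
theorem measure_excess_risk_le [IsProbabilityMeasure μ] {B G lam : ℝ} (hB : 0 < B) (hG : 0 ≤ G)
    (hint : ∀ w ∈ l1Ball d B, Integrable (f w) μ) (hL : IsLipschitzLoss (l1Ball d B) f G)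
    {Ω : Type*} [MeasurableSpace Ω] {ν : Measure Ω} [IsProbabilityMeasure ν] {ζ : ℕ → Ω → Z}
    (hζ : IsIIDSample ν μ ζ) {n : ℕ} (hn : 2 ≤ n) {δ : ℝ} (hδ : 0 < δ)
    {s V : Vec d → Vec d → ℝ}
    (hs : ∀ w ∈ l1Ball d B, ∀ v ∈ l1Ball d B, 0 < s w v ∧ 2 * (G * ‖w - v‖) * s w v ≤ 1)
    (hV : ∀ w ∈ l1Ball d B, ∀ v ∈ l1Ball d B, ∫ z, (f w z - f v z) ^ 2 ∂μ ≤ V w v)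
    {bound : ℝ}
    (hbound : ∀ w ∈ l1Ball d B, ∃ v ∈ l1Ball d B,
      ∀ w' ∈ l1Ball d B, ∀ v' ∈ l1Ball d B, ‖w - w'‖ ≤ B / n ^ 2 → ‖v - v'‖ ≤ B / n ^ 2 →
      risk μ f lam w - risk μ f lam v ≤ 2 * G * ‖w - v‖ →
      risk μ f lam w - risk μ f lam v
        ≤ s w' v' * V w' v' + netLevel d n δ / s w' v' + 4 * G * (B / n ^ 2) →
      risk μ f lam w - optimalValue (l1Ball d B) (risk μ f lam) ≤ bound) :
    ν {ω | ∃ w ∈ minimizers (l1Ball d B) (empiricalRisk f lam n (fun i => ζ i ω)),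
      bound < risk μ f lam w - optimalValue (l1Ball d B) (risk μ f lam)} ≤ ENNReal.ofReal δ := by
  obtain ⟨N, hNK, hN, hmeas⟩ := exists_net_deviation_bound hB hint hL hζ hn hδ hs hV
  refine (measure_mono ?_).trans hmeas
  rintro ω ⟨w, hw, hlt⟩
  obtain ⟨v, hv, h⟩ := hbound w hw.1
  obtain ⟨w', hw', hww⟩ := hN w hw.1
  obtain ⟨v', hv', hvv⟩ := hN v hv
  refine ⟨w', hw', v', hv', ?_⟩
  -- If the Bernstein bound held at the nearby net pair, moving it back to `(w, v)` would bring the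
  -- excess risk below `bound`.
  by_contra! hdev
  have h1 := risk_sub_le_deviation (μ := μ) hw hv
  have h2 := hL.deviation_le_deviation_add hG hint n (fun i => ζ i ω) hw.1 hv (hNK w' hw')
    (hNK v' hv') hww hvv
  refine hlt.not_ge (h w' (hNK w' hw') v' (hNK v' hv') hww hvv
    (h1.trans (hL.deviation_le hG hint n _ hw.1 hv)) ?_)
  linarith

end Deviation

/-! ### Empirical risk minimization -/

section ERM

variable {Z : Type*} [MeasurableSpace Z] {μ : Measure Z} {f : Vec d → Z → ℝ}

lemma EBC.exists_minimizer {K : Set (Vec d)} {P : Vec d → ℝ} {α : ℝ} (h : EBC K P 1 α)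
    {w : Vec d} (hw : w ∈ K) :
    ∃ v ∈ minimizers K P, ‖w - v‖ ^ 2 ≤ α * (P w - P v) := by
  obtain ⟨v, hv, -, hle⟩ := h w hw
  exact ⟨v, hv, by simpa using hle⟩

/-- Makes the rate at least `1 / (2n)`, so that the discretization error of the net is of lower
order. -/
lemma half_le_complexity (hd : d ≠ 0) {n : ℕ} (hn : 2 ≤ n) {δ : ℝ} (hδ : 0 < δ) (hδ1 : δ < 1) :
    1 / 2 ≤ d * Real.log n + Real.log (1 / δ) := by
  have h1 : Real.log 2 ≤ Real.log n := Real.log_le_log two_pos (by exact_mod_cast hn)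
  have h2 : 0 ≤ Real.log (1 / δ) := Real.log_nonneg (by rw [le_div_iff₀ hδ]; linarith)
  have h3 : (1 : ℝ) ≤ d := by exact_mod_cast Nat.one_le_iff_ne_zero.2 hd
  have := Real.log_two_gt_d9
  nlinarith

lemma netLevel_le {n : ℕ} (hn : 2 ≤ n) {δ : ℝ} (hδ : 0 < δ) (hδ1 : δ < 1) :
    netLevel d n δ ≤ 8 * ((d * Real.log n + Real.log (1 / δ)) / n) := by
  have h2 : 0 ≤ Real.log (1 / δ) := Real.log_nonneg (by rw [le_div_iff₀ hδ]; linarith)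
  rw [netLevel, ← mul_div_assoc]
  gcongr
  linarith

lemma netLevel_pos (hd : d ≠ 0) {n : ℕ} (hn : 2 ≤ n) {δ : ℝ} (hδ : 0 < δ) (hδ1 : δ < 1) :
    0 < netLevel d n δ := by
  have h1 : 0 < Real.log n := Real.log_pos (by exact_mod_cast hn)
  have h2 : 0 ≤ Real.log (1 / δ) := Real.log_nonneg (by rw [le_div_iff₀ hδ]; linarith)
  have h3 : (0 : ℝ) < d := by exact_mod_cast Nat.pos_of_ne_zero hd
  have h4 : (0 : ℝ) < n := by exact_mod_cast (by omega : 0 < n)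
  rw [netLevel]
  positivity

lemma norm_sub_sq_le_of_close {w v w' v' : Vec d} {ε : ℝ} (h : ‖w - w'‖ ≤ ε)
    (h' : ‖v - v'‖ ≤ ε) : ‖w' - v'‖ ^ 2 ≤ 2 * ‖w - v‖ ^ 2 + 8 * ε ^ 2 := by
  have h1 : ‖w' - v'‖ ≤ ‖w - v‖ + 2 * ε := by
    have : w' - v' = (w - v) + ((v - v') - (w - w')) := by abel
    rw [this]
    refine (norm_add_le _ _).trans ?_
    linarith [norm_sub_le (v - v') (w - w')]
  calc ‖w' - v'‖ ^ 2 ≤ (‖w - v‖ + 2 * ε) ^ 2 := by gcongr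
    _ ≤ _ := by nlinarith [sq_nonneg (‖w - v‖ - 2 * ε)]

/-- Here `x` is the rate. From `1 / n ≤ 2x` the net radius is dominated by `x` for the Lipschitz
rate and by `x²` for the optimistic one. -/
lemma netRadius_le {B n x : ℝ} (hB : 0 < B) (hn : 2 ≤ n) (h : 1 / 2 ≤ x * n) :
    B / n ^ 2 ≤ B ∧ B / n ^ 2 ≤ 2 * B * x ∧ B / n ^ 2 ≤ 4 * B * x ^ 2 := by
  have hn0 : 0 < n := by linarith
  have h1 : n⁻¹ ≤ 1 := inv_le_one_of_one_le₀ (by linarith)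
  have h2 : n⁻¹ ≤ 2 * x := by
    rw [inv_le_iff_one_le_mul₀ hn0]; linarith
  have h0 : 0 < n⁻¹ := inv_pos.2 hn0
  have h3 : n⁻¹ ^ 2 ≤ 1 := pow_le_one₀ h0.le h1
  have h4 : n⁻¹ ^ 2 ≤ 2 * x := by nlinarith
  have h5 : n⁻¹ ^ 2 ≤ (2 * x) ^ 2 := by gcongr
  rw [div_eq_mul_inv, ← inv_pow]
  exact ⟨by nlinarith, by nlinarith, by nlinarith⟩

/-- In dimension zero, the excess risk vanishes. -/
lemma measure_excess_risk_eq_zero (hd : d = 0) {B lam : ℝ} {n : ℕ} {Ω : Type*} [MeasurableSpace Ω]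
    {ν : Measure Ω} {ζ : ℕ → Ω → Z} {bound : ℝ} (hbound : 0 ≤ bound) (hB : 0 ≤ B) :
    ν {ω | ∃ w ∈ minimizers (l1Ball d B) (empiricalRisk f lam n (fun i => ζ i ω)),
      bound < risk μ f lam w - optimalValue (l1Ball d B) (risk μ f lam)} = 0 := by
  subst hd
  have : {ω | ∃ w ∈ minimizers (l1Ball 0 B) (empiricalRisk f lam n (fun i => ζ i ω)),
      bound < risk μ f lam w - optimalValue (l1Ball 0 B) (risk μ f lam)} = ∅ := by
    refine Set.eq_empty_of_forall_notMem ?_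
    rintro ω ⟨w, -, hlt⟩
    rw [optimalValue_eq (v := w) ⟨by rw [Subsingleton.elim w 0]; exact zero_mem_l1Ball hB,
      fun u _ => by rw [Subsingleton.elim w u]⟩, sub_self] at hlt
    exact absurd hlt hbound.not_gt
  rw [this, measure_empty]

/-- Fast rate of empirical risk minimization for Lipschitz losses. -/
theorem measure_erm_lipschitz_le [IsProbabilityMeasure μ] {B G lam α : ℝ} (hB : 0 < B)
    (hG : 0 < G) (hα : 0 < α) (hint : ∀ w ∈ l1Ball d B, Integrable (f w) μ)
    (hL : IsLipschitzLoss (l1Ball d B) f G) (hE : EBC (l1Ball d B) (risk μ f lam) 1 α)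
    {Ω : Type*} [MeasurableSpace Ω] {ν : Measure Ω} [IsProbabilityMeasure ν] {ζ : ℕ → Ω → Z}
    (hζ : IsIIDSample ν μ ζ) {n : ℕ} (hn : 2 ≤ n) {δ : ℝ} (hδ : 0 < δ) (hδ1 : δ < 1) :
    ν {ω | ∃ w ∈ minimizers (l1Ball d B) (empiricalRisk f lam n (fun i => ζ i ω)),
      88 * (G * B + α * G ^ 2) * ((d * Real.log n + Real.log (1 / δ)) / n)
        < risk μ f lam w - optimalValue (l1Ball d B) (risk μ f lam)} ≤ ENNReal.ofReal δ := by
  have hn2 : (2 : ℝ) ≤ n := by exact_mod_cast hn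
  have hn0 : (0 : ℝ) < n := by linarith
  have hlogδ : 0 ≤ Real.log (1 / δ) := Real.log_nonneg (by rw [le_div_iff₀ hδ]; linarith)
  have hlogn : 0 ≤ Real.log n := Real.log_nonneg (by linarith)
  rcases eq_or_ne d 0 with hd | hd
  · rw [measure_excess_risk_eq_zero hd (by positivity) hB.le]
    positivity
  set x : ℝ := (d * Real.log n + Real.log (1 / δ)) / n with hx
  -- The inverse of the Bernstein parameter. The part `4 G B` makes the parameter admissible on a
  -- ball of diameter at most `2B`; the part `4 α G²` lets half of the excess risk absorb the
  -- variance term.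
  set M : ℝ := 4 * (G * B + α * G ^ 2) with hM
  have hM0 : 0 < M := by positivity
  have hs0 : 0 < 1 / M := by positivity
  have hhalf : 1 / 2 ≤ x * n := by
    rw [hx, div_mul_cancel₀ _ hn0.ne']; exact half_le_complexity hd hn hδ hδ1
  have hq := netLevel_le (d := d) hn hδ hδ1
  refine measure_excess_risk_le hB hG.le hint hL hζ hn hδ (s := fun _ _ => 1 / M)
    (V := fun w v => G ^ 2 * ‖w - v‖ ^ 2) (fun w hw v hv => ⟨hs0, ?_⟩) (fun w hw v hv => ?_) ?_
  · rw [mul_one_div, div_le_one hM0]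
    have h1 := norm_sub_le_of_mem_l1Ball hw hv
    have h2 : 0 ≤ α * G ^ 2 := by positivity
    nlinarith
  · have h := norm_integral_le_of_norm_le_const (μ := μ) (f := fun z => (f w z - f v z) ^ 2)
      (C := G ^ 2 * ‖w - v‖ ^ 2) (Filter.Eventually.of_forall fun z => by
        rw [Real.norm_eq_abs, abs_pow, ← mul_pow]
        exact pow_le_pow_left₀ (abs_nonneg _) (hL z w hw v hv) 2)
    rw [probReal_univ, mul_one] at h
    exact (le_abs_self _).trans h
  · intro w hw
    obtain ⟨v, hv, hwv⟩ := hE.exists_minimizer hw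
    refine ⟨v, hv.1, fun w' hw' v' hv' hww hvv _ h => ?_⟩
    rw [optimalValue_eq hv]
    set Δ := risk μ f lam w - risk μ f lam v
    set ε : ℝ := B / n ^ 2 with hε
    have hε0 : 0 < ε := by positivity
    obtain ⟨hεB, hεx, -⟩ := netRadius_le hB hn2 hhalf
    rw [← hε] at hεB hεx
    have hr := norm_sub_sq_le_of_close hww hvv
    have hx0 : 0 ≤ x := by positivity
    have h1 : 1 / M * (G ^ 2 * ‖w' - v'‖ ^ 2) ≤ Δ / 2 + 2 * G * ε := by
      rw [one_div, inv_mul_le_iff₀ hM0, hM]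
      have h2 : G ^ 2 * ‖w' - v'‖ ^ 2 ≤ G ^ 2 * (2 * (α * Δ) + 8 * ε ^ 2) := by gcongr; linarith
      have h3 : 0 ≤ G * B * Δ := mul_nonneg (by positivity) (sub_nonneg.2 (hv.2 w hw))
      have h4 : G ^ 2 * ε ^ 2 ≤ G ^ 2 * (B * ε) := by gcongr; nlinarith
      have h5 : 0 ≤ α * G ^ 2 * (G * ε) := by positivity
      nlinarith
    have h2 : netLevel d n δ / (1 / M) ≤ 8 * x * M := by
      rw [div_div_eq_mul_div, div_one]; gcongr
    have h3 : G * ε ≤ G * (2 * B * x) := by gcongr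
    have h4 : 0 ≤ α * G ^ 2 * x := by positivity
    have h5 : 0 ≤ G * B * x := by positivity
    rw [hM] at h2
    nlinarith

end ERM

/-! ### Empirical risk minimization with non-negative smooth losses -/

section SmoothERM

/-- The constant in the self-bounding property of non-negative smooth Lipschitz functions. -/
def selfBound (B G L ρ : ℝ) : ℝ := 2 * (L + 2 * (G + L * B) / ρ)

lemma selfBound_pos {B G L ρ : ℝ} (hB : 0 < B) (hG : 0 < G) (hL : 0 ≤ L) (hρ : 0 < ρ) :
    0 < selfBound B G L ρ := by
  unfold selfBound; positivity

/-- Self-bounding property: the increments of a non-negative smooth function are controlled by its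
values. -/
lemma sq_sub_le_of_smooth {h : Vec d → ℝ} {p : Vec d} {B G L ρ : ℝ} (hB : 0 < B) (hG : 0 < G)
    (hL : 0 ≤ L) (hρ : 0 < ρ) {w v : Vec d}
    (hnonneg : ∀ u ∈ Metric.ball v ρ, 0 ≤ h u)
    (hsmooth : ∀ u, u = w ∨ u ∈ Metric.ball v ρ → 0 ≤ h u - h v - inner ℝ p (u - v) ∧
      h u - h v - inner ℝ p (u - v) ≤ L / 2 * ‖u - v‖ ^ 2)
    (hlip : |h w - h v| ≤ G * ‖w - v‖) (hwv : ‖w - v‖ ≤ 2 * B) :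
    (h w - h v) ^ 2 ≤ 2 * selfBound B G L ρ * ‖w - v‖ ^ 2 * h v + L ^ 2 / 2 * ‖w - v‖ ^ 4 := by
  set r := ‖w - v‖ with hr
  set b := inner ℝ p (w - v) with hb
  obtain ⟨hw1, hw2⟩ := hsmooth w (Or.inl rfl)
  rcases eq_or_lt_of_le (norm_nonneg (w - v)) with h0 | hr0
  · have : w = v := by rw [← sub_eq_zero, ← norm_eq_zero]; exact h0.symm
    subst this
    simp [hr]
  rw [← hr] at hr0
  set A := G + L * B with hA
  have hA0 : 0 < A := by positivity
  -- A gradient step length: `k L ≤ 1` gives descent, and `k A < ρ` keeps the new point in the ball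
  -- where the function is non-negative, since `A` bounds the slope along `w - v`.
  set k := 1 / (L + 2 * A / ρ) with hk
  have hden : 0 < L + 2 * A / ρ := by positivity
  have hk0 : 0 < k := by positivity
  have hkL : k * L ≤ 1 := by
    rw [hk, div_mul_eq_mul_div, one_mul, div_le_one hden]
    have : 0 ≤ 2 * A / ρ := by positivity
    linarith
  have hkA : k * A < ρ := by
    rw [hk, div_mul_eq_mul_div, one_mul, div_lt_iff₀ hden]
    have : ρ * (L + 2 * A / ρ) = ρ * L + 2 * A := by field_simp
    rw [this]
    have : 0 ≤ ρ * L := by positivity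
    linarith
  have habs := abs_le.1 hlip
  have hbA : |b| ≤ A * r := by
    have : L / 2 * r ^ 2 ≤ L * B * r := by
      have := mul_le_mul_of_nonneg_left hwv (mul_nonneg hL hr0.le)
      nlinarith
    rw [abs_le, hA]
    constructor <;> nlinarith [mul_nonneg (mul_nonneg hL hB.le) hr0.le]
  -- One descent step from `v` along the line through `w`. Non-negativity at the new point and
  -- smoothness bound `b²` by the value at `v`.
  set t := k * b / r ^ 2 with ht
  have hu : v - t • (w - v) ∈ Metric.ball v ρ := by
    rw [Metric.mem_ball, dist_eq_norm, sub_sub_cancel_left, norm_neg, norm_smul, Real.norm_eq_abs,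
      ht, abs_div, abs_mul, abs_of_pos hk0, abs_of_pos (pow_pos hr0 2), ← hr]
    have : k * |b| / r ^ 2 * r = k * (|b| / r) := by field_simp
    rw [this]
    have h1 : |b| / r ≤ A := by rwa [div_le_iff₀ hr0]
    nlinarith
  have h1 := hnonneg _ hu
  have h2 := (hsmooth _ (Or.inr hu)).2
  rw [sub_sub_cancel_left, inner_neg_right, inner_smul_right, norm_neg, norm_smul, mul_pow,
    Real.norm_eq_abs, sq_abs, ← hr, ← hb] at h2
  have hb2 : b ^ 2 ≤ selfBound B G L ρ * r ^ 2 * h v := by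
    have e1 : t * b = k * (b ^ 2 / r ^ 2) := by rw [ht]; ring
    have e2 : L / 2 * (t ^ 2 * r ^ 2) = (k * L) * k * (b ^ 2 / r ^ 2) / 2 := by
      rw [ht]; field_simp
    rw [e1, e2] at h2
    have hy : 0 ≤ b ^ 2 / r ^ 2 := by positivity
    have h3 : (k * L) * k * (b ^ 2 / r ^ 2) ≤ 1 * k * (b ^ 2 / r ^ 2) := by gcongr
    have h4 : k * (b ^ 2 / r ^ 2) ≤ 2 * h v := by nlinarith
    have h5 : b ^ 2 / r ^ 2 ≤ selfBound B G L ρ * h v := by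
      have : selfBound B G L ρ = 2 / k := by rw [selfBound, hk, ← hA]; field_simp
      rw [this, div_mul_eq_mul_div, le_div_iff₀ hk0]
      linarith
    rw [div_le_iff₀ (by positivity)] at h5
    linarith
  -- The increment is its linear part plus a remainder in `[0, L r² / 2]`; the claim follows from
  -- `(b + e)² ≤ 2 b² + 2 e²`.
  set e := h w - h v - b with he
  have he2 : e ^ 2 ≤ (L / 2 * r ^ 2) ^ 2 := by gcongr
  have hsum : h w - h v = b + e := by ring
  rw [hsum]
  nlinarith [sq_nonneg (b - e)]

lemma IsNonnegSmoothConvexLoss.sq_sub_le {Z : Type*} {f : Vec d → Z → ℝ}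
    {B G L ρ : ℝ} (hB : 0 < B) (hG : 0 < G) (hL : 0 ≤ L)
    (hρ : 0 < ρ) (hlip : IsLipschitzLoss (l1Ball d B) f G)
    (hf : IsNonnegSmoothConvexLoss (Metric.thickening ρ (l1Ball d B)) f L) {w v : Vec d}
    (hw : w ∈ l1Ball d B) (hv : v ∈ l1Ball d B) (z : Z) :
    (f w z - f v z) ^ 2
      ≤ 2 * selfBound B G L ρ * ‖w - v‖ ^ 2 * f v z + L ^ 2 / 2 * ‖w - v‖ ^ 4 := by
  have hsub := Metric.self_subset_thickening hρ (l1Ball d B)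
  have hball : Metric.ball v ρ ⊆ Metric.thickening ρ (l1Ball d B) :=
    Metric.ball_subset_thickening hv ρ
  obtain ⟨h1, -, h3⟩ := hf z
  exact sq_sub_le_of_smooth (h := fun u => f u z) hB hG hL hρ (fun u hu => h1 u (hball hu))
    (fun u hu => h3 u (hu.elim (fun h => h ▸ hsub hw) fun h => hball h) v (hsub hv))
    (hlip z w hw v hv) (norm_sub_le_of_mem_l1Ball hw hv)

variable {Z : Type*} [MeasurableSpace Z] {μ : Measure Z} {f : Vec d → Z → ℝ}

/-- The growth parameter `1 / (12 α)`. -/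
def smoothEta (α : ℝ) : ℝ := 1 / (12 * α)

/-- The constant of the optimistic rate. -/
def smoothConst (α B G L ρ : ℝ) : ℝ :=
  192 * smoothEta α * B ^ 2
    + 32 * selfBound B G L ρ * G * B * smoothEta α
    + 128 * (G ^ 2 + 1) / smoothEta α + 32 * G * B + 32 * selfBound B G L ρ / smoothEta α
    + 4 * G * B * (4 * (L ^ 2 + 1) / smoothEta α ^ 2) ^ 2

/-- The arithmetic behind the optimistic rate: a self-bounding inequality for the excess risk `Δ`
is solved for `Δ`. -/
lemma excess_le_of_self_bounding {B G L H η α q x P Δ ε r F W : ℝ} (hB : 0 < B) (hG : 0 < G)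
    (hH : 0 < H) (hη0 : 0 < η) (hηα : η * α = 1 / 12) (hP0 : 0 ≤ P)
    (hq0 : 0 < q) (hq : q ≤ 8 * x) (hsmall : q ≤ 2 * η ^ 2 / (L ^ 2 + 1)) (hε0 : 0 < ε)
    (hεx : ε ≤ 4 * B * x ^ 2) (hεB : ε ≤ B) (hr0 : 0 ≤ r)
    (hr : r ^ 2 ≤ 2 * (α * Δ) + 8 * ε ^ 2) (hF0 : 0 ≤ F) (hF : F ≤ P + G * ε)
    (hW : W = 2 * H * F + L ^ 2 / 2 * r ^ 2 + 2 * G * η * r + q)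
    (h : Δ ≤ η / W * (2 * H * r ^ 2 * F + L ^ 2 / 2 * r ^ 4) + q / (η / W) + 4 * G * ε) :
    Δ ≤ (192 * η * B ^ 2 + 32 * H * G * B * η + 128 * (G ^ 2 + 1) / η + 32 * G * B) * x ^ 2
      + 32 * H / η * (x * P) := by
  have hWpos : 0 < W := by rw [hW]; positivity
  -- `W` dominates the second-moment bound divided by `r²`, so the variance term costs only `η r²`.
  have h1 : η / W * (2 * H * r ^ 2 * F + L ^ 2 / 2 * r ^ 4) ≤ η * r ^ 2 := by
    rw [div_mul_eq_mul_div, div_le_iff₀ hWpos, hW]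
    have : 0 ≤ η * r ^ 2 * (2 * G * η * r + q) := by positivity
    nlinarith
  have hqL : q * (L ^ 2 / 2) ≤ η ^ 2 := by
    rw [le_div_iff₀ (by positivity)] at hsmall
    nlinarith
  -- In `q W` the part with `L²` is absorbed by smallness of `q`, and the cross term satisfies `2 G
  -- η r q ≤ η² r² + G² q²`.
  have h2 : q / (η / W) ≤ 2 * η * r ^ 2 + 2 * H / η * (q * P) + 2 * H * G / η * (q * ε)
      + (G ^ 2 + 1) / η * q ^ 2 := by
    rw [div_div_eq_mul_div, div_le_iff₀ hη0, hW]
    have e : (2 * η * r ^ 2 + 2 * H / η * (q * P) + 2 * H * G / η * (q * ε)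
      + (G ^ 2 + 1) / η * q ^ 2) * η = 2 * η ^ 2 * r ^ 2 + 2 * H * q * (P + G * ε)
        + (G ^ 2 + 1) * q ^ 2 := by
      field_simp; ring
    rw [e]
    have i1 : 2 * H * q * F ≤ 2 * H * q * (P + G * ε) :=
      mul_le_mul_of_nonneg_left hF (by positivity)
    have i2 : q * (L ^ 2 / 2) * r ^ 2 ≤ η ^ 2 * r ^ 2 := by gcongr
    nlinarith [sq_nonneg (η * r - G * q)]
  -- The value `η = 1 / (12 α)` is fixed here: the total `3 η r²` uses up half of the excess risk.
  have h3 : 3 * η * r ^ 2 ≤ Δ / 2 + 24 * η * ε ^ 2 := by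
    have : 3 * η * r ^ 2 ≤ 3 * η * (2 * (α * Δ) + 8 * ε ^ 2) := by gcongr
    have e : 3 * η * (2 * (α * Δ) + 8 * ε ^ 2) = 6 * (η * α) * Δ + 24 * η * ε ^ 2 := by ring
    rw [e, hηα] at this
    linarith
  have h4 : Δ ≤ 48 * η * ε ^ 2 + 4 * H / η * (q * P) + 4 * H * G / η * (q * ε)
      + 2 * (G ^ 2 + 1) / η * q ^ 2 + 8 * G * ε := by
    have e1 : 4 * H / η * (q * P) = 2 * (2 * H / η * (q * P)) := by ring
    have e2 : 4 * H * G / η * (q * ε) = 2 * (2 * H * G / η * (q * ε)) := by ring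
    have e3 : 2 * (G ^ 2 + 1) / η * q ^ 2 = 2 * ((G ^ 2 + 1) / η * q ^ 2) := by ring
    rw [e1, e2, e3]
    linarith
  have hq2 : q ≤ 2 * η ^ 2 := hsmall.trans (div_le_self (by positivity) (by nlinarith))
  have t1 : 48 * η * ε ^ 2 ≤ 192 * η * B ^ 2 * x ^ 2 := by
    have : ε ^ 2 ≤ B * (4 * B * x ^ 2) := by rw [sq]; gcongr
    calc 48 * η * ε ^ 2 ≤ 48 * η * (B * (4 * B * x ^ 2)) := by gcongr
      _ = _ := by ring
  have t2 : 4 * H / η * (q * P) ≤ 32 * H / η * (x * P) := by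
    calc 4 * H / η * (q * P) ≤ 4 * H / η * (8 * x * P) := by gcongr
      _ = _ := by ring
  have t3 : 4 * H * G / η * (q * ε) ≤ 32 * H * G * B * η * x ^ 2 := by
    calc 4 * H * G / η * (q * ε) ≤ 4 * H * G / η * (2 * η ^ 2 * (4 * B * x ^ 2)) := by gcongr
      _ = _ := by field_simp; ring
  have t4 : 2 * (G ^ 2 + 1) / η * q ^ 2 ≤ 128 * (G ^ 2 + 1) / η * x ^ 2 := by
    calc 2 * (G ^ 2 + 1) / η * q ^ 2 ≤ 2 * (G ^ 2 + 1) / η * (8 * x) ^ 2 := by gcongr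
      _ = _ := by ring
  have t5 : 8 * G * ε ≤ 32 * G * B * x ^ 2 := by
    calc 8 * G * ε ≤ 8 * G * (4 * B * x ^ 2) := by gcongr
      _ = _ := by ring
  linarith

/-- Optimistic fast rate of empirical risk minimization for non-negative smooth losses. -/
theorem measure_erm_smooth_le [IsProbabilityMeasure μ] {B G lam α L ρ : ℝ} (hB : 0 < B)
    (hG : 0 < G) (hα : 0 < α) (hlam : 0 ≤ lam) (hL0 : 0 ≤ L) (hρ : 0 < ρ)
    (hint : ∀ w ∈ l1Ball d B, Integrable (f w) μ)
    (hL : IsLipschitzLoss (l1Ball d B) f G) (hE : EBC (l1Ball d B) (risk μ f lam) 1 α)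
    (hf : IsNonnegSmoothConvexLoss (Metric.thickening ρ (l1Ball d B)) f L)
    {Ω : Type*} [MeasurableSpace Ω] {ν : Measure Ω} [IsProbabilityMeasure ν] {ζ : ℕ → Ω → Z}
    (hζ : IsIIDSample ν μ ζ) {n : ℕ} (hn : 2 ≤ n) {δ : ℝ} (hδ : 0 < δ) (hδ1 : δ < 1) :
    ν {ω | ∃ w ∈ minimizers (l1Ball d B) (empiricalRisk f lam n (fun i => ζ i ω)),
      smoothConst α B G L ρ * (((d * Real.log n + Real.log (1 / δ)) / n) ^ 2
        + (d * Real.log n + Real.log (1 / δ))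
          * optimalValue (l1Ball d B) (risk μ f lam) / n)
        < risk μ f lam w - optimalValue (l1Ball d B) (risk μ f lam)} ≤ ENNReal.ofReal δ := by
  have hn2 : (2 : ℝ) ≤ n := by exact_mod_cast hn
  have hn0 : (0 : ℝ) < n := by linarith
  have hlogδ : 0 ≤ Real.log (1 / δ) := Real.log_nonneg (by rw [le_div_iff₀ hδ]; linarith)
  have hlogn : 0 ≤ Real.log n := Real.log_nonneg (by linarith)
  have hsub := Metric.self_subset_thickening hρ (l1Ball d B)
  have hFnonneg : ∀ u ∈ l1Ball d B, 0 ≤ expectedLoss μ f u := fun u hu =>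
    integral_nonneg fun z => (hf z).1 u (hsub hu)
  have hFle : ∀ u, expectedLoss μ f u ≤ risk μ f lam u := fun u => by
    have := mul_nonneg hlam (l1Norm_nonneg u)
    simp only [risk]; linarith
  have hH := selfBound_pos hB hG hL0 hρ
  set H := selfBound B G L ρ with hHdef
  set η := smoothEta α with hη
  have hη0 : 0 < η := by rw [hη, smoothEta]; positivity
  have hηα : η * α = 1 / 12 := by rw [hη, smoothEta]; field_simp
  have hP0 : 0 ≤ optimalValue (l1Ball d B) (risk μ f lam) := by
    obtain ⟨v, hv, -⟩ := hE.exists_minimizer (zero_mem_l1Ball hB.le)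
    rw [optimalValue_eq hv]
    exact (hFnonneg v hv.1).trans (hFle v)
  have hC0 : 0 ≤ smoothConst α B G L ρ := by
    rw [smoothConst, ← hη, ← hHdef]; positivity
  rcases eq_or_ne d 0 with hd | hd
  · rw [measure_excess_risk_eq_zero hd (by positivity) hB.le]
    positivity
  set x : ℝ := (d * Real.log n + Real.log (1 / δ)) / n with hx
  set Popt := optimalValue (l1Ball d B) (risk μ f lam) with hPopt
  have hxP : (d * Real.log n + Real.log (1 / δ)) * Popt / n = x * Popt := by rw [hx]; ring
  rw [hxP]
  have hhalf : 1 / 2 ≤ x * n := by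
    rw [hx, div_mul_cancel₀ _ hn0.ne']; exact half_le_complexity hd hn hδ hδ1
  have hx0 : 0 ≤ x := by positivity
  have hq := netLevel_le (d := d) hn hδ hδ1
  have hq0 := netLevel_pos hd hn hδ hδ1
  set q := netLevel d n δ with hqdef
  rw [← hx] at hq
  -- The Bernstein parameter `η / W` depends on the pair. The summand linear in the distance makes
  -- it admissible, and `q > 0` keeps `W` positive at coinciding points.
  set W : Vec d → Vec d → ℝ := fun w v =>
    2 * H * expectedLoss μ f v + L ^ 2 / 2 * ‖w - v‖ ^ 2 + 2 * G * η * ‖w - v‖ + q with hW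
  have hW0 : ∀ w, ∀ v ∈ l1Ball d B, 0 < W w v := fun w v hv => by
    have := hFnonneg v hv
    simp only [hW]; positivity
  refine measure_excess_risk_le hB hG.le hint hL hζ hn hδ (s := fun w v => η / W w v)
    (V := fun w v => 2 * H * ‖w - v‖ ^ 2 * expectedLoss μ f v + L ^ 2 / 2 * ‖w - v‖ ^ 4)
    (fun w hw v hv => ⟨div_pos hη0 (hW0 w v hv), ?_⟩) (fun w hw v hv => ?_) ?_
  · rw [← mul_div_assoc, div_le_one (hW0 w v hv)]
    have := hFnonneg v hv
    have h2 : 0 ≤ 2 * H * expectedLoss μ f v + L ^ 2 / 2 * ‖w - v‖ ^ 2 + q := by positivity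
    simp only [hW]; linarith
  · have hi : Integrable (fun z => 2 * H * ‖w - v‖ ^ 2 * f v z) μ := (hint v hv).const_mul _
    have h := integral_mono_of_nonneg (μ := μ) (f := fun z => (f w z - f v z) ^ 2)
      (Filter.Eventually.of_forall fun z => sq_nonneg _)
      (hi.add (integrable_const (L ^ 2 / 2 * ‖w - v‖ ^ 4)))
      (Filter.Eventually.of_forall fun z => hf.sq_sub_le hB hG hL0 hρ hL hw hv z)
    refine h.trans_eq ?_
    simp only [Pi.add_apply]
    rw [integral_add hi (integrable_const _), integral_const_mul]
    simp [expectedLoss, hHdef]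
  · intro w hw
    obtain ⟨v, hv, hwv⟩ := hE.exists_minimizer hw
    refine ⟨v, hv.1, fun w' hw' v' hv' hww hvv htriv h => ?_⟩
    have hPv : Popt = risk μ f lam v := optimalValue_eq hv
    rw [hPv] at hP0 ⊢
    have hPF : expectedLoss μ f v ≤ risk μ f lam v := hFle v
    set P := risk μ f lam v
    set Δ := risk μ f lam w - P
    have hΔ0 : 0 ≤ Δ := sub_nonneg.2 (hv.2 w hw)
    have hxP0 : 0 ≤ x * P := by positivity
    -- If `q` is large, the rate `x` is bounded below by a constant, and the trivial estimate `2 G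
    -- ‖w - v‖ ≤ 4 G B` is already at most a constant times `x²`.
    rcases le_or_gt q (2 * η ^ 2 / (L ^ 2 + 1)) with hsmall | hlarge
    · set ε : ℝ := B / n ^ 2 with hε
      have hε0 : 0 < ε := by positivity
      obtain ⟨hεB, -, hεx⟩ := netRadius_le hB hn2 hhalf
      rw [← hε] at hεB hεx
      have hr := norm_sub_sq_le_of_close hww hvv
      have hF' : expectedLoss μ f v' ≤ P + G * ε := by
        have h1 := (abs_le.1 (hL.abs_expectedLoss_sub_le hint hv.1 hv')).1
        have h2 : G * ‖v - v'‖ ≤ G * ε := by gcongr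
        linarith
      have hF0 := hFnonneg v' hv'
      have hmain := excess_le_of_self_bounding hB hG hH hη0 hηα hP0 hq0 hq hsmall hε0 hεx hεB
        (norm_nonneg _) (hr.trans (by linarith)) (hFnonneg v' hv') hF' rfl h
      have u1 : 192 * η * B ^ 2 + 32 * H * G * B * η + 128 * (G ^ 2 + 1) / η + 32 * G * B
          ≤ smoothConst α B G L ρ := by
        rw [smoothConst, ← hη, ← hHdef]
        have : 0 ≤ 32 * H / η + 4 * G * B * (4 * (L ^ 2 + 1) / η ^ 2) ^ 2 := by positivity
        linarith
      have u2 : 32 * H / η ≤ smoothConst α B G L ρ := by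
        rw [smoothConst, ← hη, ← hHdef]
        have : 0 ≤ 192 * η * B ^ 2 + 32 * H * G * B * η + 128 * (G ^ 2 + 1) / η + 32 * G * B
          + 4 * G * B * (4 * (L ^ 2 + 1) / η ^ 2) ^ 2 := by positivity
        linarith
      have u3 := mul_le_mul_of_nonneg_right u1 (sq_nonneg x)
      have u4 := mul_le_mul_of_nonneg_right u2 hxP0
      rw [mul_add]
      linarith
    · have h1 : 1 ≤ 4 * (L ^ 2 + 1) / η ^ 2 * x := by
        rw [div_lt_iff₀ (by positivity)] at hlarge
        rw [div_mul_eq_mul_div, le_div_iff₀ (by positivity)]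
        nlinarith [mul_le_mul_of_nonneg_right hq (by positivity : 0 ≤ L ^ 2 + 1)]
      have h2 : 4 * G * B * (4 * (L ^ 2 + 1) / η ^ 2) ^ 2 ≤ smoothConst α B G L ρ := by
        rw [smoothConst, ← hη, ← hHdef]
        have : 0 ≤ 192 * η * B ^ 2 + 32 * H * G * B * η + 128 * (G ^ 2 + 1) / η + 32 * G * B
          + 32 * H / η := by positivity
        linarith
      have h3 := norm_sub_le_of_mem_l1Ball hw hv.1
      have h4 := mul_le_mul_of_nonneg_right h2 (sq_nonneg x)
      have h5 : 4 * G * B ≤ 4 * G * B * (4 * (L ^ 2 + 1) / η ^ 2) ^ 2 * x ^ 2 := by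
        rw [mul_assoc (4 * G * B), ← mul_pow]
        exact le_mul_of_one_le_right (by positivity) (one_le_pow₀ h1)
      have h6 : 2 * G * ‖w - v‖ ≤ 2 * G * (2 * B) := by gcongr
      have h7 := mul_nonneg hC0 hxP0
      rw [mul_add]
      linarith

end SmoothERM

/-! ### Projected subgradient steps -/

section Iterates

variable {K : Set (Vec d)}

lemma convex_inter_closedBall (hK : Convex ℝ K) (c : Vec d) (R : ℝ) :
    Convex ℝ (K ∩ Metric.closedBall c R) := hK.inter (convex_closedBall c R)

lemma isClosed_inter_closedBall (hc : IsClosed K) (c : Vec d) (R : ℝ) :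
    IsClosed (K ∩ Metric.closedBall c R) := hc.inter Metric.isClosed_closedBall

lemma center_mem_inter_closedBall {c : Vec d} (hc : c ∈ K) {R : ℝ} (hR : 0 ≤ R) :
    c ∈ K ∩ Metric.closedBall c R := ⟨hc, Metric.mem_closedBall_self hR⟩

/-- An approximate variational inequality. The point `p` belongs to the ball about `c`, not the one
about `c'`; contracting it towards `c'` by the factor `R / (R + ‖c - c'‖)` brings it into the
latter, and convexity keeps it in `K`. -/
lemma inner_proj_inter_closedBall_le (hK : Convex ℝ K) (hcl : IsClosed K) {R : ℝ} (hR : 0 ≤ R)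
    {c c' : Vec d} (hc' : c' ∈ K) (x : Vec d) {p : Vec d} (hpK : p ∈ K) (hp : ‖p - c‖ ≤ R) :
    inner ℝ (x - proj (K ∩ Metric.closedBall c' R) x)
      (p - proj (K ∩ Metric.closedBall c' R) x) ≤ ‖c - c'‖ * ‖x - c'‖ := by
  set K' := K ∩ Metric.closedBall c' R with hK'
  have hK'c : Convex ℝ K' := convex_inter_closedBall hK c' R
  have hK'cl : IsClosed K' := isClosed_inter_closedBall hcl c' R
  have hcK' : c' ∈ K' := center_mem_inter_closedBall hc' hR
  set p' := proj K' x
  rcases eq_or_ne c c' with rfl | hne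
  · have hpK' : p ∈ K' := ⟨hpK, by rwa [Metric.mem_closedBall, dist_eq_norm]⟩
    simpa using inner_sub_proj_le hK'c hK'cl hpK' x
  set δ := ‖c - c'‖ with hδ
  have hδ0 : 0 < δ := norm_pos_iff.2 (sub_ne_zero.2 hne)
  have hRδ : 0 < R + δ := by linarith
  set η := δ / (R + δ) with hη
  have hη0 : 0 ≤ η := by positivity
  have hη1 : η ≤ 1 := by rw [hη, div_le_one hRδ]; linarith
  have hpc' : ‖p - c'‖ ≤ R + δ := by
    have : p - c' = (p - c) + (c - c') := by abel
    rw [this]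
    exact (norm_add_le _ _).trans (by linarith)
  have hu : p + η • (c' - p) ∈ K' := by
    refine ⟨hK.add_smul_sub_mem hpK hc' ⟨hη0, hη1⟩, ?_⟩
    rw [Metric.mem_closedBall, dist_eq_norm]
    have : p + η • (c' - p) - c' = (1 - η) • (p - c') := by module
    rw [this, norm_smul, Real.norm_eq_abs, abs_of_nonneg (by linarith)]
    have h1 : 1 - η = R / (R + δ) := by rw [hη]; field_simp; ring
    rw [h1, div_mul_eq_mul_div, div_le_iff₀ hRδ]
    gcongr
  have h1 := inner_sub_proj_le hK'c hK'cl hu x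
  have h2 : p + η • (c' - p) - p' = (p - p') + η • (c' - p) := by abel
  rw [h2, inner_add_right, inner_smul_right] at h1
  have h3 := abs_le.1 (abs_real_inner_le_norm (x - p') (c' - p))
  have h4 : ‖x - p'‖ ≤ ‖x - c'‖ := by
    rw [norm_sub_rev, norm_sub_rev x]; exact (proj_spec hK'cl ⟨c', hcK'⟩ x).2 c' hcK'
  have h5 : ‖x - p'‖ * ‖c' - p‖ ≤ ‖x - c'‖ * (R + δ) := by
    rw [norm_sub_rev c' p]
    exact mul_le_mul h4 hpc' (norm_nonneg _) (norm_nonneg _)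
  have h6 : η * (‖x - c'‖ * (R + δ)) = δ * ‖x - c'‖ := by rw [hη]; field_simp
  nlinarith

/-- Sum of the two approximate variational inequalities with the centers exchanged. The resulting
Hölder dependence on the center is what makes stages with a random center measurable. -/
lemma norm_proj_inter_closedBall_sub_sq_le (hK : Convex ℝ K) (hcl : IsClosed K) {R : ℝ}
    (hR : 0 ≤ R) {c c' : Vec d} (hc : c ∈ K) (hc' : c' ∈ K) (x : Vec d) :
    ‖proj (K ∩ Metric.closedBall c R) x - proj (K ∩ Metric.closedBall c' R) x‖ ^ 2
      ≤ ‖c - c'‖ * (‖x - c‖ + ‖x - c'‖) := by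
  have hp := proj_mem (isClosed_inter_closedBall hcl c R)
    ⟨c, center_mem_inter_closedBall hc hR⟩ x
  have hp' := proj_mem (isClosed_inter_closedBall hcl c' R)
    ⟨c', center_mem_inter_closedBall hc' hR⟩ x
  have h1 := inner_proj_inter_closedBall_le hK hcl hR hc' x hp.1
    (by simpa [dist_eq_norm] using hp.2)
  have h2 := inner_proj_inter_closedBall_le hK hcl hR hc x hp'.1
    (by simpa [dist_eq_norm] using hp'.2)
  rw [norm_sub_rev c' c] at h2
  set p := proj (K ∩ Metric.closedBall c R) x
  set p' := proj (K ∩ Metric.closedBall c' R) x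
  have h3 : ‖p - p'‖ ^ 2 = inner ℝ (x - p') (p - p') + inner ℝ (x - p) (p' - p) := by
    rw [← real_inner_self_eq_norm_sq]
    simp only [inner_sub_left, inner_sub_right]; ring
  linarith

/-- The projection onto the part of `K` in a ball with center in `K` depends continuously on the
center and the point. -/
lemma continuous_proj_inter_closedBall (hK : Convex ℝ K) (hcl : IsClosed K) (hne : K.Nonempty)
    {R : ℝ} (hR : 0 ≤ R) :
    Continuous fun p : Vec d × Vec d => proj (K ∩ Metric.closedBall (proj K p.1) R) p.2 := by
  have hcont : Continuous (proj K) := (lipschitzWith_proj hK hcl hne).continuous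
  have hmem : ∀ c, proj K c ∈ K := fun c => proj_mem hcl hne c
  rw [continuous_iff_continuousAt]
  rintro ⟨c₀, x₀⟩
  rw [ContinuousAt, tendsto_iff_dist_tendsto_zero]
  have hlim : Filter.Tendsto (fun p : Vec d × Vec d => ‖p.2 - x₀‖
      + √(‖proj K p.1 - proj K c₀‖ * (‖x₀ - proj K p.1‖ + ‖x₀ - proj K c₀‖)))
      (nhds (c₀, x₀)) (nhds 0) := by
    have : Continuous fun p : Vec d × Vec d => ‖p.2 - x₀‖
      + √(‖proj K p.1 - proj K c₀‖ * (‖x₀ - proj K p.1‖ + ‖x₀ - proj K c₀‖)) := by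
      fun_prop
    simpa using this.tendsto (c₀, x₀)
  refine squeeze_zero (fun _ => dist_nonneg) (fun p => ?_) hlim
  refine (dist_triangle _ (proj (K ∩ Metric.closedBall (proj K p.1) R) x₀) _).trans
    (add_le_add ?_ ?_)
  · have h := (lipschitzWith_proj (convex_inter_closedBall hK (proj K p.1) R)
      (isClosed_inter_closedBall hcl _ R)
      ⟨_, center_mem_inter_closedBall (hmem p.1) hR⟩).dist_le_mul p.2 x₀
    simpa [dist_eq_norm] using h
  · rw [dist_eq_norm]
    exact Real.le_sqrt_of_sq_le
      (norm_proj_inter_closedBall_sub_sq_le hK hcl hR (hmem p.1) (hmem c₀) x₀)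

/-- Regret bound for projected gradient steps. -/
lemma sum_inner_le_of_proj_steps (hK : Convex ℝ K) (hcl : IsClosed K) {γ H : ℝ} {y h : ℕ → Vec d}
    (hy : ∀ t, y (t + 1) = proj K (y t - γ • h t)) {u : Vec d} (hu : u ∈ K)
    (hh : ∀ t, ‖h t‖ ≤ H) (T : ℕ) :
    2 * γ * ∑ t ∈ Finset.range T, inner ℝ (h t) (y t - u)
      ≤ ‖y 0 - u‖ ^ 2 + T * (γ ^ 2 * H ^ 2) := by
  suffices h1 : ‖y T - u‖ ^ 2 + 2 * γ * ∑ t ∈ Finset.range T, inner ℝ (h t) (y t - u)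
      ≤ ‖y 0 - u‖ ^ 2 + T * (γ ^ 2 * H ^ 2) by linarith [sq_nonneg ‖y T - u‖]
  induction T with
  | zero => simp
  | succ T ih =>
    have h1 := norm_proj_sub_le hK hcl hu (y T - γ • h T)
    rw [← hy] at h1
    have h2 : ‖y T - γ • h T - u‖ ^ 2
        = ‖y T - u‖ ^ 2 - 2 * γ * inner ℝ (h T) (y T - u) + γ ^ 2 * ‖h T‖ ^ 2 := by
      have : y T - γ • h T - u = (y T - u) - γ • h T := by abel
      rw [this, norm_sub_sq_real, inner_smul_right, norm_smul, mul_pow, Real.norm_eq_abs, sq_abs,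
        real_inner_comm]
      ring
    have h3 : γ ^ 2 * ‖h T‖ ^ 2 ≤ γ ^ 2 * H ^ 2 := by
      have := hh T
      gcongr
    rw [Finset.sum_range_succ]
    push_cast
    linarith

variable {Z : Type*} {g : Vec d → Z → Vec d}

lemma ssgIter_mem (hcl : IsClosed K) {γ : ℝ} {w₁ : Vec d} (hw₁ : w₁ ∈ K) (z : ℕ → Z) (t : ℕ) :
    ssgIter g K γ w₁ z t ∈ K := by
  cases t with
  | zero => exact hw₁
  | succ t => exact proj_mem hcl ⟨w₁, hw₁⟩ _

lemma ssg_mem (hK : Convex ℝ K) (hcl : IsClosed K) {γ : ℝ} {w₁ : Vec d} (hw₁ : w₁ ∈ K)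
    (z : ℕ → Z) (T : ℕ) : ssg g K γ w₁ z T ∈ K := by
  rw [ssg, Finset.smul_sum]
  refine hK.sum_mem (fun _ _ => by positivity) ?_ fun t _ => ssgIter_mem hcl hw₁ z t
  simp
  field_simp

lemma map_ssg_le {P : Vec d → ℝ} (hP : ConvexOn ℝ K P) (hcl : IsClosed K) {γ : ℝ} {w₁ : Vec d}
    (hw₁ : w₁ ∈ K) (z : ℕ → Z) (T : ℕ) :
    P (ssg g K γ w₁ z T)
      ≤ 1 / ((T : ℝ) + 1) * ∑ t ∈ Finset.range (T + 1), P (ssgIter g K γ w₁ z t) := by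
  rw [ssg, Finset.smul_sum, Finset.mul_sum]
  refine hP.map_sum_le (fun _ _ => by positivity) ?_ fun t _ => ssgIter_mem hcl hw₁ z t
  simp
  field_simp

/-- The iterates of the projected subgradient method driven by the noise
`gbar (w_t) - g (w_t) (z_t)` of the oracle along the iterates `w_t` of the stochastic subgradient
method. -/
def ghostIter (g : Vec d → Z → Vec d) (gbar : Vec d → Vec d) (K : Set (Vec d)) (γ : ℝ)
    (w₁ : Vec d) (z : ℕ → Z) : ℕ → Vec d
  | 0 => w₁
  | t + 1 => proj K (ghostIter g gbar K γ w₁ z t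
      - γ • (gbar (ssgIter g K γ w₁ z t) - g (ssgIter g K γ w₁ z t) (z t)))

lemma ghostIter_mem {gbar : Vec d → Vec d} (hcl : IsClosed K) {γ : ℝ} {w₁ : Vec d} (hw₁ : w₁ ∈ K)
    (z : ℕ → Z) (t : ℕ) : ghostIter g gbar K γ w₁ z t ∈ K := by
  cases t with
  | zero => exact hw₁
  | succ t => exact proj_mem hcl ⟨w₁, hw₁⟩ _

/-- The noise of the oracle at `v` in the direction `v - y`. -/
def oracleNoise (g : Vec d → Z → Vec d) (gbar : Vec d → Vec d) (p : Vec d × Vec d) (z : Z) : ℝ :=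
  inner ℝ (gbar p.1 - g p.1 z) (p.1 - p.2)

/-- The excess risk of a stage of the stochastic subgradient method with respect to any point of its
domain, in terms of the noise of the oracle along the iterates. -/
theorem ssg_sub_le {P : Vec d → ℝ} (hP : ConvexOn ℝ K P) (hcl : IsClosed K) {Γ R : ℝ}
    (hΓ : 0 < Γ) (hR : 0 < R) {gbar : Vec d → Vec d} (hg : ∀ w ∈ K, ∀ z, ‖g w z‖ ≤ Γ)
    (hgbar : ∀ w ∈ K, ‖gbar w‖ ≤ Γ)
    (hsub : ∀ w ∈ K, ∀ u ∈ K, P w + inner ℝ (gbar w) (u - w) ≤ P u) {c : Vec d} (hc : c ∈ K)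
    (hKR : ∀ w ∈ K, ‖w - c‖ ≤ R) (z : ℕ → Z) (T : ℕ) {γ θ : ℝ} (hγ : γ = R / (Γ * √((T : ℝ) + 1)))
    (hS : ∑ t ∈ Finset.range T,
      oracleNoise g gbar (ssgIter g K γ c z t, ghostIter g gbar K γ c z t) (z t)
        ≤ Γ * R * √((T : ℝ) + 1) * θ) {u : Vec d} (hu : u ∈ K) :
    P (ssg g K γ c z T) - P u ≤ Γ * ((11 / 2 + θ) / √((T : ℝ) + 1)) * R := by
  set v := ssgIter g K γ c z with hv
  set y := ghostIter g gbar K γ c z with hy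
  have hvK : ∀ t, v t ∈ K := ssgIter_mem hcl hc z
  set N : ℝ := (T : ℝ) + 1 with hN
  have hN1 : 1 ≤ N := by simp [hN]
  have hN0 : 0 < N := by linarith
  have hsN : 1 ≤ √N := Real.one_le_sqrt.2 hN1
  have hsN0 : 0 < √N := by linarith
  have hsq : √N * √N = N := Real.mul_self_sqrt hN0.le
  have hγ0 : 0 < γ := by rw [hγ]; positivity
  have hγΓ : γ * (Γ * √N) = R := by rw [hγ]; field_simp
  have hTN : (T : ℝ) ≤ N := by simp [hN]
  have hγT : T * (γ ^ 2 * Γ ^ 2) ≤ R ^ 2 := by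
    calc T * (γ ^ 2 * Γ ^ 2) ≤ N * (γ ^ 2 * Γ ^ 2) := by gcongr
      _ = (γ * (Γ * √N)) ^ 2 := by rw [mul_pow, mul_pow, sq (√N), hsq]; ring
      _ = R ^ 2 := by rw [hγΓ]
  have hcu : ‖c - u‖ ^ 2 ≤ R ^ 2 := by
    have := hKR u hu
    rw [norm_sub_rev] at this
    gcongr
  have hreg1 := sum_inner_le_of_proj_steps hP.1 hcl (γ := γ) (y := v) (h := fun t => g (v t) (z t))
    (fun t => rfl) hu (fun t => hg _ (hvK t) _) T
  -- The ghost sequence `y` splits the noise against `v t - u` into noise against `v t - y t`, which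
  -- does not involve `u`, and noise against `y t - u`, bounded by regret for all `u` at once. This
  -- matters because the comparison point will be random.
  have hreg2 := sum_inner_le_of_proj_steps hP.1 hcl (γ := γ) (y := y) (H := 2 * Γ)
    (h := fun t => gbar (v t) - g (v t) (z t)) (fun t => rfl) hu
    (fun t => (norm_sub_le _ _).trans (by linarith [hg _ (hvK t) (z t), hgbar _ (hvK t)])) T
  have hv0 : v 0 = c := rfl
  have hy0 : y 0 = c := rfl
  rw [hv0] at hreg1
  rw [hy0] at hreg2
  set A := ∑ t ∈ Finset.range T, inner ℝ (g (v t) (z t)) (v t - u)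
  set A' := ∑ t ∈ Finset.range T, inner ℝ (gbar (v t) - g (v t) (z t)) (y t - u)
  set S := ∑ t ∈ Finset.range T, oracleNoise g gbar (v t, y t) (z t) with hSdef
  -- The two regret bounds contribute `2 R²` and `5 R²`; division by `2 γ` gives `7 / 2`.
  have hAA : A + A' ≤ 7 / 2 * (Γ * R * √N) := by
    have h1 : 2 * γ * (A + A') ≤ 7 * R ^ 2 := by
      have e : T * (γ ^ 2 * (2 * Γ) ^ 2) = 4 * (T * (γ ^ 2 * Γ ^ 2)) := by ring
      rw [e] at hreg2
      linarith
    have h2 : 7 * R ^ 2 = 2 * γ * (7 / 2 * (Γ * R * √N)) := by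
      rw [sq]; nth_rewrite 1 [← hγΓ]; ring
    rw [h2] at h1
    exact le_of_mul_le_mul_left h1 (by positivity)
  have hpoint : ∀ t, P (v t) - P u ≤ inner ℝ (gbar (v t)) (v t - u) := fun t => by
    have h := hsub _ (hvK t) u hu
    rw [← neg_sub (v t) u, inner_neg_right] at h
    linarith
  have hsum : ∑ t ∈ Finset.range T, (P (v t) - P u) ≤ A + A' + S := by
    rw [hSdef, ← Finset.sum_add_distrib, ← Finset.sum_add_distrib]
    refine Finset.sum_le_sum fun t _ => (hpoint t).trans_eq ?_
    simp only [oracleNoise, inner_sub_left, inner_sub_right]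
    ring
  -- The average has one more iterate than there are samples in the stage. The last one is bounded
  -- trivially, raising `7 / 2` to `11 / 2`.
  have hlast : P (v T) - P u ≤ 2 * (Γ * R) := by
    refine (hpoint T).trans ((real_inner_le_norm _ _).trans ?_)
    have h1 : ‖v T - u‖ ≤ 2 * R := by
      have : v T - u = (v T - c) - (u - c) := by abel
      rw [this]
      exact (norm_sub_le _ _).trans (by linarith [hKR _ (hvK T), hKR u hu])
    calc ‖gbar (v T)‖ * ‖v T - u‖ ≤ Γ * (2 * R) :=
          mul_le_mul (hgbar _ (hvK T)) h1 (norm_nonneg _) hΓ.le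
      _ = _ := by ring
  have hJ := map_ssg_le (g := g) (γ := γ) hP hcl hc z T
  have htot : ∑ t ∈ Finset.range (T + 1), P (v t) - N * P u
      ≤ Γ * R * √N * (11 / 2 + θ) := by
    have e : ∑ t ∈ Finset.range (T + 1), P (v t) - N * P u
        = ∑ t ∈ Finset.range T, (P (v t) - P u) + (P (v T) - P u) := by
      rw [Finset.sum_range_succ, Finset.sum_sub_distrib]
      simp only [Finset.sum_const, Finset.card_range, nsmul_eq_mul, hN]
      ring
    rw [e]
    have h1 : Γ * R ≤ Γ * R * √N := le_mul_of_one_le_right (by positivity) hsN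
    linarith
  calc P (ssg g K γ c z T) - P u
      ≤ 1 / N * ∑ t ∈ Finset.range (T + 1), P (v t) - P u := by linarith
    _ = (∑ t ∈ Finset.range (T + 1), P (v t) - N * P u) / N := by field_simp
    _ ≤ Γ * R * √N * (11 / 2 + θ) / N := by gcongr
    _ = Γ * R * (11 / 2 + θ) * (√N / N) := by ring
    _ = Γ * ((11 / 2 + θ) / √N) * R := by rw [Real.sqrt_div_self']; ring

lemma asaIter_mem {Γ : ℝ} (hK : Convex ℝ K) (hcl : IsClosed K) {R₀ : ℝ} (hR₀ : 0 ≤ R₀) {w₁ : Vec d}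
    (hw₁ : w₁ ∈ K) (n₀ : ℕ) (z : ℕ → Z) (k : ℕ) : asaIter g K Γ R₀ w₁ n₀ z k ∈ K := by
  induction k with
  | zero => exact hw₁
  | succ k ih =>
    exact (ssg_mem (convex_inter_closedBall hK _ _) (isClosed_inter_closedBall hcl _ _)
      (center_mem_inter_closedBall ih (by positivity)) _ _).1

/-- With `R₀ = 0` all the balls are single points and the method never moves. -/
lemma asaIter_eq_self {Γ : ℝ} (hK : Convex ℝ K) (hcl : IsClosed K) {w₁ : Vec d} (hw₁ : w₁ ∈ K) (n₀ : ℕ)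
    (z : ℕ → Z) (k : ℕ) : asaIter g K Γ 0 w₁ n₀ z k = w₁ := by
  induction k with
  | zero => rfl
  | succ k ih =>
    have h := (ssg_mem (g := g) (γ := 0 / 2 ^ k / (Γ * √((n₀ : ℝ) + 1)))
      (convex_inter_closedBall hK (asaIter g K Γ 0 w₁ n₀ z k) (0 / 2 ^ k))
      (isClosed_inter_closedBall hcl _ _)
      (center_mem_inter_closedBall (by rw [ih]; exact hw₁) (by simp))
      (fun t => z (k * n₀ + t)) n₀).2
    rw [zero_div, Metric.closedBall_zero, Set.mem_singleton_iff, ih] at h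
    rw [asaIter, zero_div, Metric.closedBall_zero, ih]
    exact h

end Iterates

/-! ### A martingale concentration inequality along a sample -/

section Azuma

variable {Z : Type*} [MeasurableSpace Z] {Ω : Type*}

/-- The σ-algebra generated by the first `i` sample points. -/
abbrev past (ζ : ℕ → Ω → Z) (i : ℕ) : MeasurableSpace Ω :=
  ⨆ j ∈ Set.Iio i, MeasurableSpace.comap (ζ j) inferInstance

lemma past_mono (ζ : ℕ → Ω → Z) {i j : ℕ} (h : i ≤ j) : past ζ i ≤ past ζ j :=
  biSup_mono fun _ hk => lt_of_lt_of_le hk h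

lemma measurable_past (ζ : ℕ → Ω → Z) {i j : ℕ} (h : i < j) : Measurable[past ζ j] (ζ i) :=
  measurable_iff_comap_le.2 (le_biSup (fun k => MeasurableSpace.comap (ζ k) _) h)

variable [MeasurableSpace Ω] {ν : Measure Ω} {μ : Measure Z} {ζ : ℕ → Ω → Z}

lemma IsIIDSample.past_le (hζ : IsIIDSample ν μ ζ) (i : ℕ) : past ζ i ≤ ‹MeasurableSpace Ω› :=
  iSup₂_le fun j _ => (hζ.measurable j).comap_le

variable {β : Type*} [MeasurableSpace β]

lemma IsIIDSample.indepFun_past (hζ : IsIIDSample ν μ ζ) {i : ℕ} {X : Ω → β}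
    (hX : Measurable[past ζ i] X) : IndepFun X (ζ i) ν := by
  have h := indep_iSup_of_disjoint (fun j => (hζ.measurable j).comap_le) hζ.indep
    (S := Set.Iio i) (T := {i}) (by simp)
  rw [iSup_singleton] at h
  exact indep_of_indep_of_le_left h (measurable_iff_comap_le.1 hX)

/-- Conditioning on the past by Tonelli: a past-measurable `X` and the next sample point are
independent, so their joint law is a product. -/
lemma IsIIDSample.lintegral_past [IsProbabilityMeasure ν] [IsProbabilityMeasure μ]
    (hζ : IsIIDSample ν μ ζ) {i : ℕ} {X : Ω → β} (hX : Measurable[past ζ i] X)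
    {h : β × Z → ENNReal} (hh : Measurable h) :
    ∫⁻ ω, h (X ω, ζ i ω) ∂ν = ∫⁻ ω, ∫⁻ z, h (X ω, z) ∂μ ∂ν := by
  have hXm : Measurable X := hX.mono (hζ.past_le i) le_rfl
  have hprod := (indepFun_iff_map_prod_eq_prod_map_map hXm.aemeasurable
    (hζ.measurable i).aemeasurable).1 (hζ.indepFun_past hX)
  rw [hζ.law i] at hprod
  have : IsProbabilityMeasure (ν.map X) := Measure.isProbabilityMeasure_map hXm.aemeasurable
  rw [← lintegral_map (f := h) (g := fun ω => (X ω, ζ i ω)) hh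
    (hXm.prodMk (hζ.measurable i)), hprod, lintegral_prod _ hh.aemeasurable,
    lintegral_map hh.lintegral_prod_right' hXm]

/-- Hoeffding's lemma, in the form to be iterated with `IsIIDSample.lintegral_past`. -/
lemma lintegral_exp_le_of_abs_le [IsProbabilityMeasure μ] {Y : Z → ℝ} (hY : Measurable Y) {b : ℝ}
    (hb : ∀ z, |Y z| ≤ b) (h0 : ∫ z, Y z ∂μ = 0) (s : ℝ) :
    ∫⁻ z, ENNReal.ofReal (Real.exp (s * Y z)) ∂μ ≤ ENNReal.ofReal (Real.exp (s ^ 2 * b ^ 2 / 2)) := by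
  have hsub := hasSubgaussianMGF_of_mem_Icc_of_integral_eq_zero (μ := μ) (a := -b) (b := b)
    hY.aemeasurable (Filter.Eventually.of_forall fun z => abs_le.1 (hb z)) h0
  have hmgf := hsub.mgf_le s
  rw [← ofReal_integral_eq_lintegral_ofReal (hsub.integrable_exp_mul s)
    (Filter.Eventually.of_forall fun z => (Real.exp_pos _).le)]
  refine ENNReal.ofReal_le_ofReal (hmgf.trans_eq ?_)
  congr 1
  have : ((‖b - -b‖₊ / 2) ^ 2 : NNReal) = (b ^ 2 : ℝ) := by
    push_cast
    rw [Real.norm_eq_abs, sub_neg_eq_add, ← two_mul, abs_mul, abs_two, mul_div_cancel_left₀ _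
      two_ne_zero, sq_abs]
  rw [this]
  ring

/-- An Azuma-Hoeffding inequality: `φ (X t, ·)` is a bounded centered function of the sample point
`ζ (i + t)`, chosen in dependence on the previous sample points. -/
theorem IsIIDSample.measure_sum_ge_le [IsProbabilityMeasure ν] [IsProbabilityMeasure μ]
    (hζ : IsIIDSample ν μ ζ) {φ : β → Z → ℝ} (hφ : Measurable (Function.uncurry φ)) {i : ℕ}
    {X : ℕ → Ω → β} (hX : ∀ t, Measurable[past ζ (i + t)] (X t)) {b : ℝ}
    (hb : ∀ t ω z, |φ (X t ω) z| ≤ b) (h0 : ∀ t ω, ∫ z, φ (X t ω) z ∂μ = 0) {s : ℝ} (hs : 0 < s)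
    (T : ℕ) (a : ℝ) :
    ν {ω | a ≤ ∑ t ∈ Finset.range T, φ (X t ω) (ζ (i + t) ω)}
      ≤ ENNReal.ofReal (Real.exp (-s * a + T * (s ^ 2 * b ^ 2 / 2))) := by
  set S : ℕ → Ω → ℝ := fun T ω => ∑ t ∈ Finset.range T, φ (X t ω) (ζ (i + t) ω) with hS
  have hSm : ∀ T, Measurable[past ζ (i + T)] (S T) := fun T => by
    refine Finset.measurable_sum _ fun t ht => ?_
    have ht' : t < T := Finset.mem_range.1 ht
    exact hφ.comp (((hX t).mono (past_mono ζ (by omega)) le_rfl).prodMk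
      (measurable_past ζ (by omega)))
  have hexp : ∀ T, ∫⁻ ω, ENNReal.ofReal (Real.exp (s * S T ω)) ∂ν
      ≤ ENNReal.ofReal (Real.exp (T * (s ^ 2 * b ^ 2 / 2))) := by
    intro T
    induction T with
    | zero => simp [hS]
    | succ T ih =>
      -- The partial sum and `X T` together are determined by the past, so the last sample point can
      -- be integrated out first.
      let h : (ℝ × β) × Z → ENNReal := fun p =>
        ENNReal.ofReal (Real.exp (s * (p.1.1 + φ p.1.2 p.2)))
      have hh : Measurable h := by
        have : Measurable fun p : (ℝ × β) × Z => φ p.1.2 p.2 :=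
          hφ.comp (measurable_fst.snd.prodMk measurable_snd)
        exact ((measurable_fst.fst.add this).const_mul s).exp.ennreal_ofReal
      have hstep := hζ.lintegral_past (X := fun ω => (S T ω, X T ω)) ((hSm T).prodMk (hX T)) hh
      have hlhs : ∀ ω, ENNReal.ofReal (Real.exp (s * S (T + 1) ω))
          = h ((S T ω, X T ω), ζ (i + T) ω) := fun ω => by
        simp only [hS, Finset.sum_range_succ, h]
      simp_rw [hlhs, hstep]
      have hinner : ∀ ω, ∫⁻ z, h ((S T ω, X T ω), z) ∂μ
          ≤ ENNReal.ofReal (Real.exp (s * S T ω))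
            * ENNReal.ofReal (Real.exp (s ^ 2 * b ^ 2 / 2)) := fun ω => by
        have hYm : Measurable fun z => φ (X T ω) z := hφ.comp measurable_prodMk_left
        have hle := lintegral_exp_le_of_abs_le hYm (hb T ω) (h0 T ω) s
        have : ∀ z, h ((S T ω, X T ω), z) = ENNReal.ofReal (Real.exp (s * S T ω))
            * ENNReal.ofReal (Real.exp (s * φ (X T ω) z)) := fun z => by
          simp only [h]
          rw [mul_add, Real.exp_add, ENNReal.ofReal_mul (Real.exp_pos _).le]
        simp_rw [this]
        rw [lintegral_const_mul _ (hYm.const_mul s).exp.ennreal_ofReal]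
        gcongr
      calc _ ≤ ∫⁻ ω, ENNReal.ofReal (Real.exp (s * S T ω))
            * ENNReal.ofReal (Real.exp (s ^ 2 * b ^ 2 / 2)) ∂ν := lintegral_mono hinner
        _ = (∫⁻ ω, ENNReal.ofReal (Real.exp (s * S T ω)) ∂ν)
            * ENNReal.ofReal (Real.exp (s ^ 2 * b ^ 2 / 2)) :=
          lintegral_mul_const' _ _ ENNReal.ofReal_ne_top
        _ ≤ ENNReal.ofReal (Real.exp (T * (s ^ 2 * b ^ 2 / 2)))
            * ENNReal.ofReal (Real.exp (s ^ 2 * b ^ 2 / 2)) := by gcongr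
        _ = _ := by
          rw [← ENNReal.ofReal_mul (Real.exp_pos _).le, ← Real.exp_add]
          push_cast
          ring_nf
  have hSm' : Measurable (S T) := (hSm T).mono (hζ.past_le _) le_rfl
  have hmark := meas_ge_le_lintegral_div (μ := ν)
    (f := fun ω => ENNReal.ofReal (Real.exp (s * S T ω)))
    ((hSm'.const_mul s).exp.ennreal_ofReal.aemeasurable)
    (ε := ENNReal.ofReal (Real.exp (s * a))) (by simpa using Real.exp_pos _) ENNReal.ofReal_ne_top
  calc ν {ω | a ≤ S T ω}
      ≤ ν {ω | ENNReal.ofReal (Real.exp (s * a)) ≤ ENNReal.ofReal (Real.exp (s * S T ω))} :=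
        measure_mono fun ω (hω : a ≤ S T ω) => ENNReal.ofReal_le_ofReal
          (Real.exp_le_exp.2 (mul_le_mul_of_nonneg_left hω hs.le))
    _ ≤ _ := hmark
    _ ≤ ENNReal.ofReal (Real.exp (T * (s ^ 2 * b ^ 2 / 2))) / ENNReal.ofReal (Real.exp (s * a)) := by
        gcongr
        exact hexp T
    _ = _ := by
        rw [← ENNReal.ofReal_div_of_pos (Real.exp_pos _), ← Real.exp_sub]
        ring_nf

end Azuma

/-! ### Adaptive stochastic approximation -/

section ASA

variable {Z : Type*} [MeasurableSpace Z] {K : Set (Vec d)} {μ : Measure Z} {P : Vec d → ℝ}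
  {g : Vec d → Z → Vec d} {Γ : ℝ}

/-- The mean of the oracle. -/
def oracleMean (μ : Measure Z) (g : Vec d → Z → Vec d) (w : Vec d) : Vec d := ∫ z, g w z ∂μ

section Oracle

variable [IsProbabilityMeasure μ]

lemma IsStochasticSubgradient.measurable_oracleMean
    (hg : IsStochasticSubgradient K μ P g Γ) : Measurable (oracleMean μ g) :=
  (hg.measurable.stronglyMeasurable.integral_prod_right).measurable

lemma IsStochasticSubgradient.norm_oracleMean_le
    (hg : IsStochasticSubgradient K μ P g Γ) {w : Vec d} (hw : w ∈ K) :
    ‖oracleMean μ g w‖ ≤ Γ := by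
  simpa [oracleMean] using norm_integral_le_of_norm_le_const (μ := μ)
    (Filter.Eventually.of_forall (hg.norm_le w hw))

lemma IsStochasticSubgradient.measurable_oracleNoise
    (hg : IsStochasticSubgradient K μ P g Γ) :
    Measurable (Function.uncurry (oracleNoise g (oracleMean μ g))) := by
  have h1 : Measurable fun q : (Vec d × Vec d) × Z => oracleMean μ g q.1.1 :=
    hg.measurable_oracleMean.comp measurable_fst.fst
  have h2 : Measurable fun q : (Vec d × Vec d) × Z => g q.1.1 q.2 :=
    hg.measurable.comp (measurable_fst.fst.prodMk measurable_snd)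
  exact (h1.sub h2).inner (measurable_fst.fst.sub measurable_fst.snd)

lemma IsStochasticSubgradient.abs_oracleNoise_le
    (hg : IsStochasticSubgradient K μ P g Γ) {p : Vec d × Vec d} (hp : p.1 ∈ K) {D : ℝ}
    (hD : ‖p.1 - p.2‖ ≤ D) (hΓ : 0 ≤ Γ) (z : Z) :
    |oracleNoise g (oracleMean μ g) p z| ≤ 2 * Γ * D := by
  refine (abs_real_inner_le_norm _ _).trans (mul_le_mul ?_ hD (norm_nonneg _) (by positivity))
  refine (norm_sub_le _ _).trans ?_
  linarith [hg.norm_oracleMean_le hp, hg.norm_le _ hp z]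

lemma IsStochasticSubgradient.integral_oracleNoise
    (hg : IsStochasticSubgradient K μ P g Γ) {p : Vec d × Vec d} (hp : p.1 ∈ K) :
    ∫ z, oracleNoise g (oracleMean μ g) p z ∂μ = 0 := by
  have hgi : Integrable (g p.1) μ :=
    Integrable.of_bound (hg.measurable.comp measurable_prodMk_left).aestronglyMeasurable Γ
      (Filter.Eventually.of_forall (hg.norm_le _ hp))
  have hi : Integrable (fun z => oracleMean μ g p.1 - g p.1 z) μ := (integrable_const _).sub hgi
  have h := integral_inner (𝕜 := ℝ) hi (p.1 - p.2)
  simp only [oracleNoise]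
  simp_rw [real_inner_comm (p.1 - p.2)]
  rw [h, integral_sub (integrable_const _) hgi]
  simp [oracleMean]

variable {Ω : Type*} {ζ : ℕ → Ω → Z}

/-- The domain of a stage is random through its center, so measurability rests on joint continuity
of the projection in center and point. Iterate `t` sees only samples before `i + t`, so its noise is
centered given the past. -/
lemma IsStochasticSubgradient.measurable_iterates
    (hg : IsStochasticSubgradient K μ P g Γ) (hK : Convex ℝ K) (hcl : IsClosed K)
    (hne : K.Nonempty) {R : ℝ} (hR : 0 ≤ R) (γ : ℝ) {i : ℕ} {C : Ω → Vec d} (hC : Measurable[past ζ i] C)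
    (hCK : ∀ ω, C ω ∈ K) (t : ℕ) :
    Measurable[past ζ (i + t)] (fun ω => ssgIter g (K ∩ Metric.closedBall (C ω) R) γ (C ω)
        (fun j => ζ (i + j) ω) t) ∧
      Measurable[past ζ (i + t)] (fun ω => ghostIter g (oracleMean μ g)
        (K ∩ Metric.closedBall (C ω) R) γ (C ω) (fun j => ζ (i + j) ω) t) := by
  induction t with
  | zero => exact ⟨hC, hC⟩
  | succ t ih =>
    obtain ⟨hv, hy⟩ := ih
    have hmono : past ζ (i + t) ≤ past ζ (i + (t + 1)) := past_mono ζ (by omega)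
    have hv' := hv.mono hmono le_rfl
    have hy' := hy.mono hmono le_rfl
    have hC' : Measurable[past ζ (i + (t + 1))] C := hC.mono (past_mono ζ (by omega)) le_rfl
    have hζ' : Measurable[past ζ (i + (t + 1))] (ζ (i + t)) := measurable_past ζ (by omega)
    have hgv := hg.measurable.comp (hv'.prodMk hζ')
    have hproj : ∀ {x : Ω → Vec d}, Measurable[past ζ (i + (t + 1))] x →
        Measurable[past ζ (i + (t + 1))] fun ω => proj (K ∩ Metric.closedBall (C ω) R) (x ω) := by
      intro x hx
      have h := (continuous_proj_inter_closedBall hK hcl hne hR).measurable.comp (hC'.prodMk hx)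
      refine (congrArg (Measurable[past ζ (i + (t + 1))]) (funext fun ω => ?_)).mp h
      simp only [Function.comp_apply, proj_eq_self hcl (hCK ω)]
    exact ⟨hproj (hv'.sub (hgv.const_smul γ)),
      hproj (hy'.sub (((hg.measurable_oracleMean.comp hv').sub hgv).const_smul γ))⟩

/-- In a stage of the adaptive stochastic approximation method, the noise of the oracle along the
iterates is sub-Gaussian. -/
theorem IsStochasticSubgradient.measure_noise_ge_le [MeasurableSpace Ω] {ν : Measure Ω}
    [IsProbabilityMeasure ν] (hg : IsStochasticSubgradient K μ P g Γ)
    (hζ : IsIIDSample ν μ ζ) (hK : Convex ℝ K)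
    (hcl : IsClosed K) (hne : K.Nonempty) (hΓ : 0 < Γ) {R : ℝ} (hR : 0 < R) (γ : ℝ) {i : ℕ} {C : Ω → Vec d}
    (hC : Measurable[past ζ i] C) (hCK : ∀ ω, C ω ∈ K) (T : ℕ) {θ : ℝ} (hθ : 0 < θ) :
    ν {ω | Γ * R * √((T : ℝ) + 1) * θ ≤ ∑ t ∈ Finset.range T, oracleNoise g (oracleMean μ g)
      (ssgIter g (K ∩ Metric.closedBall (C ω) R) γ (C ω) (fun j => ζ (i + j) ω) t,
        ghostIter g (oracleMean μ g) (K ∩ Metric.closedBall (C ω) R) γ (C ω)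
          (fun j => ζ (i + j) ω) t) (ζ (i + t) ω)}
      ≤ ENNReal.ofReal (Real.exp (-(θ ^ 2 / 32))) := by
  set N : ℝ := (T : ℝ) + 1 with hN
  have hN0 : 0 < N := by positivity
  have hsq : √N ^ 2 = N := Real.sq_sqrt hN0.le
  have hsN0 : 0 < √N := Real.sqrt_pos.2 hN0
  have hcl' : ∀ ω, IsClosed (K ∩ Metric.closedBall (C ω) R) := fun ω =>
    isClosed_inter_closedBall hcl _ _
  have hmem : ∀ ω, C ω ∈ K ∩ Metric.closedBall (C ω) R := fun ω =>
    center_mem_inter_closedBall (hCK ω) hR.le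
  have hv := fun t ω => ssgIter_mem (g := g) (γ := γ) (hcl' ω) (hmem ω) (fun j => ζ (i + j) ω) t
  have hy := fun t ω => ghostIter_mem (g := g) (γ := γ) (gbar := oracleMean μ g) (hcl' ω) (hmem ω)
    (fun j => ζ (i + j) ω) t
  -- Azuma's exponent with increments at most `4 Γ R` and `T` replaced by `T + 1` is optimized by
  -- this `s`.
  refine (hζ.measure_sum_ge_le hg.measurable_oracleNoise
    (fun t => ((hg.measurable_iterates hK hcl hne hR.le γ hC hCK t).1.prodMk
      (hg.measurable_iterates hK hcl hne hR.le γ hC hCK t).2)) (b := 2 * Γ * (2 * R))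
    (fun t ω z => hg.abs_oracleNoise_le (hv t ω).1 ?_ hΓ.le z)
    (fun t ω => hg.integral_oracleNoise (hv t ω).1)
    (s := θ / (16 * Γ * R * √N)) (by positivity) T _).trans
    (ENNReal.ofReal_le_ofReal (Real.exp_le_exp.2 ?_))
  · have h1 := (hv t ω).2
    have h2 := (hy t ω).2
    rw [← dist_eq_norm]
    refine (dist_triangle_right _ _ (C ω)).trans ?_
    rw [Metric.mem_closedBall] at h1 h2
    linarith
  · have e1 : -(θ / (16 * Γ * R * √N)) * (Γ * R * √N * θ) = -(θ ^ 2 / 16) := by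
      field_simp
    have e2 : (θ / (16 * Γ * R * √N)) ^ 2 * (2 * Γ * (2 * R)) ^ 2 / 2 = θ ^ 2 / (32 * N) := by
      rw [div_pow, mul_pow _ (√N), hsq]; field_simp; ring
    rw [e1, e2]
    have h : T * (θ ^ 2 / (32 * N)) ≤ θ ^ 2 / 32 := by
      rw [mul_div_assoc', div_le_div_iff₀ (by positivity) (by norm_num)]
      have : 0 ≤ θ ^ 2 := sq_nonneg θ
      rw [hN]; nlinarith
    linarith

end Oracle

lemma IsStochasticSubgradient.measurable_asaIter [IsProbabilityMeasure μ]
    (hg : IsStochasticSubgradient K μ P g Γ) {Ω : Type*} {ζ : ℕ → Ω → Z} (hK : Convex ℝ K)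
    (hcl : IsClosed K) {R₀ : ℝ} (hR₀ : 0 ≤ R₀) {w₁ : Vec d} (hw₁ : w₁ ∈ K) (n₀ k : ℕ) :
    Measurable[past ζ (k * n₀)] fun ω => asaIter g K Γ R₀ w₁ n₀ (fun i => ζ i ω) k := by
  induction k with
  | zero => exact measurable_const
  | succ k ih =>
    have hRk : 0 ≤ R₀ / 2 ^ k := by positivity
    have h := fun t => (hg.measurable_iterates hK hcl ⟨w₁, hw₁⟩ hRk
      (R₀ / 2 ^ k / (Γ * √((n₀ : ℝ) + 1))) ih
      (fun ω => asaIter_mem hK hcl hR₀ hw₁ n₀ (fun i => ζ i ω) k) t).1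
    -- The stage averages `n₀ + 1` iterates, but the last of them uses only the `n₀` samples of the
    -- stage.
    have hsum := Finset.measurable_sum (m := past ζ ((k + 1) * n₀)) (Finset.range (n₀ + 1))
      fun t ht => (h t).mono (past_mono ζ (by
        have := Finset.mem_range.1 ht
        rw [add_one_mul]; omega)) le_rfl
    exact (measurable_const_smul (1 / ((n₀ : ℝ) + 1))).comp hsum

/-- Excess risk after `k` stages, when every stage makes the expected progress. -/
lemma excess_risk_le_of_stages {R₀ a α : ℝ} (ha : 0 ≤ a) (hα : 0 ≤ α) (hR₀ : 0 ≤ R₀)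
    (hE : EBC K P 1 α) {C : ℕ → Vec d} (hC : ∀ k, C k ∈ K) {v : Vec d} (hv : v ∈ minimizers K P)
    (hCv : ‖C 0 - v‖ ≤ R₀) {m : ℕ}
    (hstage : ∀ k < m, ∀ u ∈ K, ‖u - C k‖ ≤ R₀ / 2 ^ k →
      P (C (k + 1)) - P u ≤ a * (R₀ / 2 ^ k)) (hm : 0 < m) :
    P (C m) - P v ≤ max (2 * a * (R₀ / 2 ^ m)) (8 * α * a ^ 2) := by
  have hval : ∀ u ∈ minimizers K P, P u = P v := fun u hu =>
    le_antisymm (hu.2 v hv.1) (hv.2 u hu.1)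
  -- Invariant: either a minimizer is within the current radius, or the excess is below its final
  -- level with room `2 a R`. The current center is itself feasible for the next stage, so a stage
  -- costs at most `a R`, which is the room lost when `R` is halved.
  have key : ∀ k ≤ m, ((∃ u ∈ minimizers K P, ‖C k - u‖ ≤ R₀ / 2 ^ k) ∧
      (0 < k → P (C k) - P v ≤ 2 * a * (R₀ / 2 ^ k))) ∨
      P (C k) - P v ≤ 8 * α * a ^ 2 - 2 * a * (R₀ / 2 ^ k) := by
    intro k
    induction k with
    | zero => exact fun _ => Or.inl ⟨⟨v, hv, by simpa using hCv⟩, fun h => absurd h (by omega)⟩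
    | succ k ih =>
      intro hk
      set R := R₀ / 2 ^ k with hR
      have hR0 : 0 ≤ R := by positivity
      have hR' : R₀ / 2 ^ (k + 1) = R / 2 := by rw [hR, pow_succ]; field_simp
      rw [hR']
      rcases ih (by omega) with ⟨⟨u, hu, hdist⟩, -⟩ | hB
      · have h1 := hstage k (by omega) u hu.1 (by rwa [norm_sub_rev])
        rw [hval u hu] at h1
        obtain ⟨w', hw', -, hle⟩ := hE _ (hC (k + 1))
        rw [Real.rpow_one, hval w' hw'] at hle
        -- The error bound gives squared distance at most `α a R`, which is at most `(R / 2)²`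
        -- exactly when `R ≥ 4 α a`.
        rcases le_or_gt (4 * α * a) R with hbig | hsmall
        · refine Or.inl ⟨⟨w', hw', ?_⟩, fun _ => by linarith⟩
          refine abs_le_of_sq_le_sq' ?_ (by positivity) |>.2
          calc ‖C (k + 1) - w'‖ ^ 2 ≤ α * (a * R) := hle.trans (by gcongr)
            _ ≤ (R / 2) ^ 2 := by nlinarith
        · refine Or.inr ?_
          nlinarith
      · refine Or.inr ?_
        have h1 := hstage k (by omega) (C k) (hC k) (by simpa using hR0)
        linarith
  have h0 : 0 ≤ 2 * a * (R₀ / 2 ^ m) := by positivity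
  rcases key m le_rfl with ⟨-, h⟩ | h
  · exact (h hm).trans (le_max_left _ _)
  · exact le_trans (by linarith) (le_max_right _ _)

/-- High-probability bound for the excess risk of `m` stages of `n₀` steps. -/
theorem measure_asaIter_le [IsProbabilityMeasure μ] (hg : IsStochasticSubgradient K μ P g Γ)
    (hP : ConvexOn ℝ K P) (hcl : IsClosed K) (hΓ : 0 < Γ) {α : ℝ} (hα : 0 ≤ α)
    (hE : EBC K P 1 α) {R₀ : ℝ} (hR₀ : 0 < R₀) {w₁ : Vec d} (hw₁ : w₁ ∈ K)
    (hdist : ∃ v ∈ minimizers K P, ‖w₁ - v‖ ≤ R₀) {Ω : Type*} [MeasurableSpace Ω]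
    {ν : Measure Ω} [IsProbabilityMeasure ν] {ζ : ℕ → Ω → Z} (hζ : IsIIDSample ν μ ζ) {m : ℕ}
    (hm : 0 < m) (n₀ : ℕ) {θ : ℝ} (hθ : 0 < θ) :
    ν {ω | max (2 * (Γ * ((11 / 2 + θ) / √((n₀ : ℝ) + 1))) * (R₀ / 2 ^ m))
        (8 * α * (Γ * ((11 / 2 + θ) / √((n₀ : ℝ) + 1))) ^ 2)
      < P (asaIter g K Γ R₀ w₁ n₀ (fun i => ζ i ω) m) - optimalValue K P}
      ≤ ENNReal.ofReal (m * Real.exp (-(θ ^ 2 / 32))) := by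
  obtain ⟨v, hv, hwv⟩ := hdist
  have hK := hP.1
  have hCK := fun ω => asaIter_mem (g := g) (Γ := Γ) hK hcl hR₀.le hw₁ n₀ (fun i => ζ i ω)
  set C : ℕ → Ω → Vec d := fun k ω => asaIter g K Γ R₀ w₁ n₀ (fun i => ζ i ω) k with hCdef
  set γ : ℕ → ℝ := fun k => R₀ / 2 ^ k / (Γ * √((n₀ : ℝ) + 1)) with hγ
  set bad : ℕ → Set Ω := fun k => {ω | Γ * (R₀ / 2 ^ k) * √((n₀ : ℝ) + 1) * θ
    ≤ ∑ t ∈ Finset.range n₀, oracleNoise g (oracleMean μ g)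
      (ssgIter g (K ∩ Metric.closedBall (C k ω) (R₀ / 2 ^ k)) (γ k) (C k ω)
        (fun j => ζ (k * n₀ + j) ω) t,
      ghostIter g (oracleMean μ g) (K ∩ Metric.closedBall (C k ω) (R₀ / 2 ^ k)) (γ k) (C k ω)
        (fun j => ζ (k * n₀ + j) ω) t) (ζ (k * n₀ + t) ω)}
  have hbad : ∀ k, ν (bad k) ≤ ENNReal.ofReal (Real.exp (-(θ ^ 2 / 32))) := fun k =>
    hg.measure_noise_ge_le hζ hK hcl ⟨w₁, hw₁⟩ hΓ (by positivity) (γ k)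
      (hg.measurable_asaIter hK hcl hR₀.le hw₁ n₀ k) (fun ω => hCK ω k) n₀ hθ
  have hsub : {ω | max (2 * (Γ * ((11 / 2 + θ) / √((n₀ : ℝ) + 1))) * (R₀ / 2 ^ m))
        (8 * α * (Γ * ((11 / 2 + θ) / √((n₀ : ℝ) + 1))) ^ 2)
      < P (C m ω) - optimalValue K P} ⊆ ⋃ k ∈ Finset.range m, bad k := by
    intro ω hω
    by_contra hnot
    simp only [Set.mem_iUnion, not_exists] at hnot
    rw [Set.mem_ofPred_eq, optimalValue_eq hv] at hω
    refine hω.not_ge (excess_risk_le_of_stages (C := fun k => C k ω) (by positivity) hα hR₀.le hE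
      (fun k => hCK ω k) hv hwv (fun k hk u hu huC => ?_) hm)
    have hb := hnot k (Finset.mem_range.2 hk)
    rw [Set.mem_ofPred_eq, not_le] at hb
    have hRk : 0 < R₀ / 2 ^ k := by positivity
    have hsubK : K ∩ Metric.closedBall (C k ω) (R₀ / 2 ^ k) ⊆ K := Set.inter_subset_left
    exact ssg_sub_le (hP.subset hsubK (convex_inter_closedBall hK _ _))
      (isClosed_inter_closedBall hcl _ _) hΓ hRk (fun w hw => hg.norm_le w hw.1)
      (fun w hw => hg.norm_oracleMean_le hw.1)
      (fun w hw u hu => hg.mean_mem w hw.1 u hu.1)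
      (center_mem_inter_closedBall (hCK ω k) hRk.le)
      (fun w hw => by simpa [dist_eq_norm] using hw.2) (fun t => ζ (k * n₀ + t) ω) n₀ rfl hb.le
      (u := u) ⟨hu, by rwa [Metric.mem_closedBall, dist_eq_norm]⟩
  calc _ ≤ ν (⋃ k ∈ Finset.range m, bad k) := measure_mono hsub
    _ ≤ ∑ k ∈ Finset.range m, ν (bad k) := measure_biUnion_finset_le _ _
    _ ≤ ∑ _k ∈ Finset.range m, ENNReal.ofReal (Real.exp (-(θ ^ 2 / 32))) :=
      Finset.sum_le_sum fun k _ => hbad k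
    _ = _ := by
      rw [ENNReal.ofReal_mul (by positivity)]
      simp

end ASA

/-! ### The number and the length of the stages -/

lemma four_le_log {n : ℕ} (hn : 100 ≤ n) : 4 ≤ Real.log n := by
  have hn' : (100 : ℝ) ≤ n := by exact_mod_cast hn
  rw [Real.le_log_iff_exp_le (by linarith)]
  have h1 : Real.exp 4 = Real.exp 1 ^ 4 := by rw [← Real.exp_nat_mul]; norm_num
  have h2 := Real.exp_one_lt_d9
  have h3 : Real.exp 1 ^ 4 ≤ (3 : ℝ) ^ 4 := by
    have := Real.exp_pos 1
    gcongr; linarith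
  rw [h1]; linarith

/-- With `Q = 2n / log₂ n` and `m` stages, the rounding gives `4 ^ (m + 1) ≤ Q < 4 ^ (m + 2)`. Thus
`4 ^ m` is of order `n / log n`, with `8 / log 2 < 12`, and `Q ≥ 16` for `n ≥ 100` ensures a stage.
-/
lemma asaStages_spec {n : ℕ} (hn : 100 ≤ n) :
    0 < asaStages n ∧ (asaStages n : ℝ) ≤ Real.log n ∧
      (n : ℝ) ≤ 12 * Real.log n * 4 ^ asaStages n := by
  have hn' : (100 : ℝ) ≤ n := by exact_mod_cast hn
  have hn0 : (0 : ℝ) < n := by linarith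
  have hl2 := Real.log_two_gt_d9
  have hl2' := Real.log_two_lt_d9
  have hl20 : 0 < Real.log 2 := by linarith
  have hlog := four_le_log hn
  have hlog100 : Real.log 100 ≤ 5 := by
    rw [Real.log_le_iff_le_exp (by norm_num)]
    have h1 : Real.exp 5 = Real.exp 1 ^ 5 := by rw [← Real.exp_nat_mul]; norm_num
    have h2 := Real.exp_one_gt_d9
    have h3 : (2.7 : ℝ) ^ 5 ≤ Real.exp 1 ^ 5 := by gcongr; linarith
    rw [h1]; norm_num at h3 ⊢; linarith
  have hlogle : Real.log n ≤ n / 20 := by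
    have h1 := Real.log_le_sub_one_of_pos (show 0 < (n : ℝ) / 100 by positivity)
    rw [Real.log_div hn0.ne' (by norm_num)] at h1
    linarith
  set Q : ℝ := 2 * n / Real.logb 2 n with hQ
  have hQeq : Q = 2 * n * Real.log 2 / Real.log n := by
    rw [hQ, Real.logb, div_div_eq_mul_div]
  have hQ16 : 16 ≤ Q := by
    rw [hQeq, le_div_iff₀ (by linarith)]; nlinarith
  have hQ0 : 0 < Q := by linarith
  have hQn : Q ≤ n := by
    rw [hQeq, div_le_iff₀ (by linarith)]; nlinarith
  have hlogQ : 4 * Real.log 2 ≤ Real.log Q := by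
    have h : Real.log 16 = 4 * Real.log 2 := by
      rw [show (16 : ℝ) = 2 ^ 4 by norm_num, Real.log_pow]; norm_num
    rw [← h]
    exact Real.log_le_log (by norm_num) hQ16
  set x : ℝ := 1 / 2 * Real.logb 2 Q with hx
  have hxeq : x * (2 * Real.log 2) = Real.log Q := by
    rw [hx, Real.logb]; field_simp
  have hx2 : 2 ≤ x := by
    by_contra! h
    nlinarith
  have hfloor : 2 ≤ ⌊x⌋₊ := Nat.le_floor (by exact_mod_cast hx2)
  have hm : asaStages n = ⌊x⌋₊ - 1 := rfl
  have hm1 : asaStages n + 1 = ⌊x⌋₊ := by omega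
  have hm1' : (asaStages n : ℝ) + 1 = (⌊x⌋₊ : ℝ) := by exact_mod_cast hm1
  refine ⟨by omega, ?_, ?_⟩
  · have h1 : (⌊x⌋₊ : ℝ) ≤ x := Nat.floor_le (by linarith)
    have h2 : Real.log Q ≤ Real.log n := Real.log_le_log hQ0 hQn
    nlinarith
  · have h1 : x < (⌊x⌋₊ : ℝ) + 1 := Nat.lt_floor_add_one x
    have h2 : Q ≤ 4 ^ (asaStages n + 2) := by
      rw [← Real.log_le_log_iff hQ0 (by positivity), Real.log_pow,
        show (4 : ℝ) = 2 ^ 2 by norm_num, Real.log_pow, ← hxeq]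
      push_cast
      nlinarith
    rw [hQeq, div_le_iff₀ (by linarith), pow_add] at h2
    have h3 : 0 < Real.log n * 4 ^ asaStages n := by positivity
    nlinarith

lemma div_stages_le {n m : ℕ} (hm : 0 < m) (hn : 0 < n) :
    1 / (((n / m : ℕ) : ℝ) + 1) ≤ m / n := by
  have h1 : n < m * (n / m + 1) := Nat.lt_mul_div_succ n hm
  have h2 : (n : ℝ) < m * (((n / m : ℕ) : ℝ) + 1) := by exact_mod_cast h1
  rw [div_le_div_iff₀ (by positivity) (by exact_mod_cast hn)]
  linarith

/-- The arithmetic of the rate of adaptive stochastic approximation. -/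
lemma asa_rate_le {n : ℕ} (hn : 100 ≤ n) {δ : ℝ} (hδ : 0 < δ) (hδ1 : δ < 1) {α Γ R₀ : ℝ}
    (hα : 0 ≤ α) (hΓ : 0 ≤ Γ) (hR₀ : 0 ≤ R₀) {s : ℝ}
    (hs : s = (11 / 2 + √(32 * Real.log (asaStages n / δ))) / √((asaStageLength n : ℝ) + 1)) :
    max (2 * (Γ * s) * (R₀ / 2 ^ asaStages n)) (8 * α * (Γ * s) ^ 2)
      ≤ 1000 * (max (α * Γ ^ 2) (R₀ * Γ) * (Real.log n * Real.log (Real.log n / δ)) / n) := by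
  obtain ⟨hm, hmlog, hn4⟩ := asaStages_spec hn
  set m := asaStages n
  have hlog := four_le_log hn
  have hn0 : (0 : ℝ) < n := by exact_mod_cast (by omega : 0 < n)
  have hm1 : (1 : ℝ) ≤ m := by exact_mod_cast hm
  set l := Real.log (Real.log n / δ) with hl
  have hl1 : 1 ≤ l := by
    rw [hl, Real.le_log_iff_exp_le (by positivity), le_div_iff₀ hδ]
    have := Real.exp_one_lt_d9
    nlinarith [Real.exp_pos 1]
  have hml : Real.log (m / δ) ≤ l := by
    refine Real.log_le_log (by positivity) ?_
    gcongr
  have hml0 : 0 ≤ Real.log (m / δ) := Real.log_nonneg (by rw [le_div_iff₀ hδ]; linarith)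
  set ℓ := Real.log n * l / n with hℓ
  have hℓ0 : 0 < ℓ := by positivity
  have hs0 : 0 ≤ s := by rw [hs]; positivity
  have hs2 : s ^ 2 ≤ 125 * ℓ := by
    set θ := √(32 * Real.log (m / δ)) with hθ
    have hθ2 : θ ^ 2 = 32 * Real.log (m / δ) := Real.sq_sqrt (by positivity)
    -- Twice the sum of squares is at most `60.5 + 64 l`, and `l ≥ 1`.
    have h1 : (11 / 2 + θ) ^ 2 ≤ 125 * l := by nlinarith [sq_nonneg (11 / 2 - θ)]
    have h2 : 1 / ((asaStageLength n : ℝ) + 1) ≤ m / n := div_stages_le hm (by omega)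
    rw [hs, div_pow, Real.sq_sqrt (by positivity), div_eq_mul_one_div]
    calc (11 / 2 + θ) ^ 2 * (1 / ((asaStageLength n : ℝ) + 1)) ≤ 125 * l * (m / n) := by gcongr
      _ ≤ 125 * l * (Real.log n / n) := by gcongr
      _ = 125 * ℓ := by rw [hℓ]; ring
  -- Squared, this combines `s² ≤ 125 ℓ` with `4 ^ (-m) ≤ 12 ℓ`; note `125 * 12 = 1500 ≤ 39²`.
  have hs4 : s / 2 ^ m ≤ 39 * ℓ := by
    refine abs_le_of_sq_le_sq' ?_ (by positivity) |>.2
    have h4 : ((2 : ℝ) ^ m) ^ 2 = 4 ^ m := by rw [← pow_mul, mul_comm, pow_mul]; norm_num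
    rw [div_pow, h4, div_le_iff₀ (by positivity)]
    have h5 : 1 ≤ 12 * (Real.log n / n) * 4 ^ m := by
      rw [mul_div_assoc', div_mul_eq_mul_div, le_div_iff₀ hn0]; linarith
    have h6 : Real.log n / n ≤ ℓ := by
      rw [hℓ]; gcongr; exact le_mul_of_one_le_right (by linarith) hl1
    calc s ^ 2 ≤ 125 * ℓ * 1 := by linarith
      _ ≤ 125 * ℓ * (12 * (Real.log n / n) * 4 ^ m) := by gcongr
      _ ≤ 125 * ℓ * (12 * ℓ * 4 ^ m) := by gcongr
      _ = 1500 * (ℓ ^ 2 * 4 ^ m) := by ring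
      _ ≤ (39 * ℓ) ^ 2 * 4 ^ m := by
        have : 0 ≤ ℓ ^ 2 * 4 ^ m := by positivity
        nlinarith
  have e : 1000 * (max (α * Γ ^ 2) (R₀ * Γ) * (Real.log n * l) / n)
      = 1000 * (max (α * Γ ^ 2) (R₀ * Γ) * ℓ) := by rw [hℓ]; ring
  rw [e]
  refine max_le ?_ ?_
  · calc 2 * (Γ * s) * (R₀ / 2 ^ m) = 2 * (R₀ * Γ) * (s / 2 ^ m) := by ring
      _ ≤ 2 * (R₀ * Γ) * (39 * ℓ) := by gcongr
      _ = 78 * (R₀ * Γ * ℓ) := by ring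
      _ ≤ 1000 * (R₀ * Γ * ℓ) := by
        have : 0 ≤ R₀ * Γ * ℓ := by positivity
        linarith
      _ ≤ _ := by gcongr; exact le_max_right _ _
  · calc 8 * α * (Γ * s) ^ 2 = 8 * (α * Γ ^ 2) * s ^ 2 := by ring
      _ ≤ 8 * (α * Γ ^ 2) * (125 * ℓ) := by gcongr
      _ = 1000 * (α * Γ ^ 2 * ℓ) := by ring
      _ ≤ _ := by gcongr; exact le_max_left _ _

/-- Fast rate of adaptive stochastic approximation. -/
theorem measure_asa_le {Z : Type*} [MeasurableSpace Z] {K : Set (Vec d)} {μ : Measure Z}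
    {P : Vec d → ℝ} {g : Vec d → Z → Vec d} {Γ : ℝ} [IsProbabilityMeasure μ]
    (hg : IsStochasticSubgradient K μ P g Γ) (hP : ConvexOn ℝ K P) (hcl : IsClosed K) (hΓ : 0 < Γ)
    {α : ℝ} (hα : 0 ≤ α) (hE : EBC K P 1 α) {R₀ : ℝ} {w₁ : Vec d} (hw₁ : w₁ ∈ K)
    (hdist : ∃ v ∈ minimizers K P, ‖w₁ - v‖ ≤ R₀) {Ω : Type*} [MeasurableSpace Ω]
    {ν : Measure Ω} [IsProbabilityMeasure ν] {ζ : ℕ → Ω → Z} (hζ : IsIIDSample ν μ ζ) {n : ℕ}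
    (hn : 100 ≤ n) {δ : ℝ} (hδ : 0 < δ) (hδ1 : δ < 1) :
    ν {ω | 1000 * (max (α * Γ ^ 2) (R₀ * Γ) * (Real.log n * Real.log (Real.log n / δ)) / n)
      < P (asa g K Γ R₀ w₁ n (fun i => ζ i ω)) - optimalValue K P} ≤ ENNReal.ofReal δ := by
  have hR₀ : 0 ≤ R₀ := by
    obtain ⟨v, -, h⟩ := hdist
    exact (norm_nonneg _).trans h
  have hrate := asa_rate_le hn hδ hδ1 hα hΓ.le hR₀ rfl
  obtain ⟨hm, -, -⟩ := asaStages_spec hn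
  have hm0 : (0 : ℝ) < asaStages n := by exact_mod_cast hm
  have hm1 : (1 : ℝ) ≤ asaStages n := by exact_mod_cast hm
  rcases hR₀.eq_or_lt with rfl | hR₀'
  · obtain ⟨v, hv, h⟩ := hdist
    have hwv : w₁ = v := by rw [← sub_eq_zero, ← norm_eq_zero]; exact le_antisymm h (norm_nonneg _)
    have hempty : {ω | 1000 * (max (α * Γ ^ 2) (0 * Γ)
        * (Real.log n * Real.log (Real.log n / δ)) / n)
        < P (asa g K Γ 0 w₁ n (fun i => ζ i ω)) - optimalValue K P} = ∅ := by
      refine Set.eq_empty_of_forall_notMem fun ω hω => ?_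
      rw [Set.mem_ofPred_eq, asa, asaIter_eq_self hP.1 hcl hw₁, optimalValue_eq hv, hwv,
        sub_self] at hω
      refine hω.not_ge (le_trans (le_max_of_le_right ?_) hrate)
      positivity
    rw [hempty, measure_empty]
    positivity
  · have hlog : 0 < Real.log (asaStages n / δ) :=
      Real.log_pos (by rw [lt_div_iff₀ hδ]; linarith)
    -- This `θ` solves `m exp (-θ² / 32) = δ`, the union bound over the stages.
    have h := measure_asaIter_le hg hP hcl hΓ hα hE hR₀' hw₁ hdist hζ hm (asaStageLength n)
      (θ := √(32 * Real.log (asaStages n / δ))) (by positivity)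
    refine (measure_mono fun ω hω => lt_of_le_of_lt hrate hω).trans (h.trans_eq ?_)
    rw [Real.sq_sqrt (by positivity), mul_div_cancel_left₀ _ (by norm_num), ← Real.log_inv,
      Real.exp_log (by positivity), inv_div, mul_div_cancel₀ _ hm0.ne']

end L1Risk

end

theorem corollary4 :
    ∃ (C₁ : ℝ → ℝ → ℝ → ℝ) (C₂ : ℝ) (κ C₃ : ℝ → ℝ → ℝ → ℝ → ℝ → ℝ),
    ∀ (d : ℕ) (Z : Type u) [MeasurableSpace Z] (μ : Measure Z) [IsProbabilityMeasure μ]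
      (f : Vec d → Z → ℝ) (B lam : ℝ),
      0 < B → 0 ≤ lam →
      (∀ w ∈ l1Ball d B, Integrable (f w) μ) →
      ConvexOn ℝ (l1Ball d B) (risk μ f lam) →
      (IsQuadraticOn (l1Ball d B) (expectedLoss μ f) ∨
        IsPiecewiseLinearOn (l1Ball d B) (expectedLoss μ f)) →
      -- the error bound condition holds with exponent one
      (∃ α : ℝ, 0 < α ∧ EBC (l1Ball d B) (risk μ f lam) 1 α) ∧
      -- rates, for every `α` for which it holds
      ∀ α : ℝ, 0 < α → EBC (l1Ball d B) (risk μ f lam) 1 α →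
      ∀ G : ℝ, 0 < G → IsLipschitzLoss (l1Ball d B) f G →
      ∀ (Ω : Type v) [MeasurableSpace Ω] (ν : Measure Ω) [IsProbabilityMeasure ν]
        (ζ : ℕ → Ω → Z), IsIIDSample ν μ ζ →
      -- empirical risk minimization
      (∀ (n : ℕ) (δ : ℝ), 2 ≤ n → 0 < δ → δ < 1 →
        ν {ω | ∃ w ∈ minimizers (l1Ball d B)
              (empiricalRisk f lam n (fun i => ζ i ω)),
            C₁ α B G * (((d : ℝ) * Real.log n + Real.log (1 / δ)) / n)
              < risk μ f lam w
                - optimalValue (l1Ball d B) (risk μ f lam)}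
          ≤ ENNReal.ofReal δ) ∧
      -- adaptive stochastic approximation
      (∀ (g : Vec d → Z → Vec d) (Γ R₀ : ℝ) (w₁ : Vec d), 0 < Γ →
        IsStochasticSubgradient (l1Ball d B) μ (risk μ f lam) g Γ →
        w₁ ∈ l1Ball d B →
        (∃ v ∈ minimizers (l1Ball d B) (risk μ f lam), ‖w₁ - v‖ ≤ R₀) →
        ∀ (n : ℕ) (δ : ℝ), 100 ≤ n → 0 < δ → δ < 1 →
        ν {ω | C₂ * (max (α * Γ ^ 2) (R₀ * Γ)
                * (Real.log n * Real.log (Real.log n / δ)) / n)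
              < risk μ f lam
                  (asa g (l1Ball d B) Γ R₀ w₁ n (fun i => ζ i ω))
                - optimalValue (l1Ball d B) (risk μ f lam)}
          ≤ ENNReal.ofReal δ) ∧
      -- empirical risk minimization with non-negative smooth convex losses
      (∀ L ρ : ℝ, 0 ≤ L → 0 < ρ →
        IsNonnegSmoothConvexLoss (Metric.thickening ρ (l1Ball d B)) f L →
        ∀ (n : ℕ) (δ : ℝ), 2 ≤ n → 0 < δ → δ < 1 →
        κ α B G L ρ * ((d : ℝ) * Real.log n) ≤ n →
        ν {ω | ∃ w ∈ minimizers (l1Ball d B)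
              (empiricalRisk f lam n (fun i => ζ i ω)),
            C₃ α B G L ρ * ((((d : ℝ) * Real.log n + Real.log (1 / δ)) / n) ^ 2
                + ((d : ℝ) * Real.log n + Real.log (1 / δ))
                  * optimalValue (l1Ball d B) (risk μ f lam) / n)
              < risk μ f lam w
                - optimalValue (l1Ball d B) (risk μ f lam)}
          ≤ ENNReal.ofReal δ) := by
  -- `κ = 0` suffices because `smoothConst` contains a term that makes the smooth bound trivial when
  -- `n` is small compared with `d log n`.
  refine ⟨fun α B G => 88 * (G * B + α * G ^ 2), 1000, fun _ _ _ _ _ => 0, smoothConst, ?_⟩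
  intro d Z _ μ _ f B lam hB hlam hint hconv hF
  refine ⟨exists_EBC_risk hB hconv hF, ?_⟩
  intro α hα hE G hG hL Ω _ ν _ ζ hζ
  refine ⟨fun n δ hn hδ hδ1 => measure_erm_lipschitz_le hB hG hα hint hL hE hζ hn hδ hδ1, ?_, ?_⟩
  · intro g Γ R₀ w₁ hΓ hg hw₁ hdist n δ hn hδ hδ1
    exact measure_asa_le hg hconv (isClosed_l1Ball B) hΓ hα.le hE hw₁ hdist hζ hn hδ hδ1
  · intro L ρ hL0 hρ hf n δ hn hδ hδ1 _
    exact measure_erm_smooth_le hB hG hα hlam hL0 hρ hint hL hE hf hζ hn hδ hδ1
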